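/- For a real $k\times k$ matrix $M$ let $G(M)=\mathbb R^k\rtimes_M\mathbb R$ be $\mathbb R^k\times\mathbb R$ with the group law $(x,t)*(x',t')=(x+e^{tM}x',\,t+t')$. If $M$ is diagonalizable over $\mathbb C$, a Jordan basis of $M$ is a basis $(e_1,\dots,e_k)$ of $\mathbb R^k$ in which $M$ is in real Jordan form, i.e. (up to the numbering of the basis) block diagonal with blocks $(a)$ and $\begin{pmatrix}\alpha&-\beta\\ \beta&\alpha\end{pmatrix}$; the group $G(M)$ is equipped with the left-invariant Riemannian metric for which $(e_1,0),\dots,(e_k,0),(0,1)$ is an orthonormal basis of the Lie algebra $\mathbb R^k\oplus\mathbb R$. The volume entropy of a Riemannian manifold is the limit $\delta=\lim_{r\to\infty}\frac{\log \operatorname{Vol}(B(p,r))}{r}$, where $B(p,r)$ is the geodesic ball of centre $p$ and radius $r$. Let $A\in\mathrm{Mat}(m\times m,\mathbb R)$ and $B\in\mathrm{Mat}(n\times n,\mathbb R)$ be diagonalizable over $\mathbb C$, with all eigenvalues of positive real part, so that $G(A)$ and $G(B)$ are abelian Heintze groups. Let $$G(A)\bowtie G(B)=(\mathbb R^m\times\mathbb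 R^n)\rtimes_{\operatorname{diag}(A,-B)}\mathbb R=G(\operatorname{diag}(A,-B))$$ be their horospherical product. Then $A$, $B$ and $\operatorname{diag}(A,-B)$ have Jordan bases, and for any choice of such bases, in each of the three groups the volume entropy exists as a limit, with geodesic balls of finite volume, and has the same value at every base point $p$; moreover $$\delta(G(A))=\operatorname{tr}(A),\qquad \delta(G(B))=\operatorname{tr}(B),\qquad \delta(G(A)\bowtie G(B))=\max\bigl(\delta(G(A)),\delta(G(B))\bigr).$$ -/

import Mathlib

open Matrix Filter Topology MeasureTheory Manifold ContDiff
open scoped ENNReal Bundle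

set_option linter.unusedSectionVars false

noncomputable section

/-- The underlying space `ℝ^ι × ℝ` of the group `G(A) = ℝ^ι ⋊_A ℝ`.  The vector space structure
only serves to provide global coordinates (the manifold structure, and the coordinate frame of each
tangent space); the group law is the (noncommutative) multiplication defined below. -/
def AbelianExt {ι : Type*} (_A : Matrix ι ι ℝ) : Type _ := (ι → ℝ) × ℝ

namespace AbelianExt

variable {ι : Type*} [Fintype ι] [DecidableEq ι] (A : Matrix ι ι ℝ)

instance : NormedAddCommGroup (AbelianExt A) :=
  inferInstanceAs (NormedAddCommGroup ((ι → ℝ) × ℝ))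

instance : NormedSpace ℝ (AbelianExt A) :=
  inferInstanceAs (NormedSpace ℝ ((ι → ℝ) × ℝ))

instance : FiniteDimensional ℝ (AbelianExt A) :=
  inferInstanceAs (FiniteDimensional ℝ ((ι → ℝ) × ℝ))

/-- Lebesgue measure of the coordinate space. -/
instance : MeasureSpace (AbelianExt A) :=
  inferInstanceAs (MeasureSpace ((ι → ℝ) × ℝ))

/-- `(x, t) * (x', t') = (x + exp(t A) x', t + t')`. -/
instance : Mul (AbelianExt A) :=
  ⟨fun p q => (p.1 + NormedSpace.exp (p.2 • A) *ᵥ q.1, p.2 + q.2)⟩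

instance : One (AbelianExt A) := ⟨((0 : ι → ℝ), (0 : ℝ))⟩

instance : Inv (AbelianExt A) :=
  ⟨fun p => (-(NormedSpace.exp ((-p.2) • A) *ᵥ p.1), -p.2)⟩

variable {A}

theorem mul_fst (p q : AbelianExt A) :
    (p * q).1 = p.1 + NormedSpace.exp (p.2 • A) *ᵥ q.1 := rfl
theorem mul_snd (p q : AbelianExt A) : (p * q).2 = p.2 + q.2 := rfl

theorem exp_add_smul (s t : ℝ) :
    NormedSpace.exp ((s + t) • A) = NormedSpace.exp (s • A) * NormedSpace.exp (t • A) := by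
  rw [add_smul]
  exact Matrix.exp_add_of_commute _ _ (((Commute.refl A).smul_left s).smul_right t)

variable (A) in
/-- The semidirect product `G(A) = ℝ^ι ⋊_A ℝ`. -/
instance : Group (AbelianExt A) :=
  Group.ofLeftAxioms
    (fun p q r => Prod.ext
      (by simp only [mul_fst, mul_snd, exp_add_smul, Matrix.mulVec_add, Matrix.mulVec_mulVec,
            add_assoc])
      (by simp only [mul_snd, add_assoc]))
    (fun p => Prod.ext
      (by
        change (0 : ι → ℝ) + NormedSpace.exp ((0 : ℝ) • A) *ᵥ p.1 = p.1
        rw [zero_smul, NormedSpace.exp_zero, Matrix.one_mulVec, zero_add])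
      (zero_add p.2))
    (fun p => Prod.ext (neg_add_cancel (NormedSpace.exp ((-p.2) • A) *ᵥ p.1))
      (neg_add_cancel p.2))

/-- The derivative at `p` of the left translation by `p⁻¹`, from the tangent space at `p` to the
tangent space at the identity (both in coordinates). -/
def dLeft (p : AbelianExt A) : AbelianExt A →L[ℝ] AbelianExt A :=
  fderiv ℝ (fun q : AbelianExt A => p⁻¹ * q) p

/-- The scalar product on the Lie algebra `𝔤 = ℝ^ι ⊕ ℝ` of `G(A)` for which
`(b i, 0)`, `i : ι`, and `(0, 1)` form an orthonormal basis. -/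
def lieInner (b : Module.Basis ι ℝ (ι → ℝ)) (v w : AbelianExt A) : ℝ :=
  (∑ i, b.repr v.1 i * b.repr w.1 i) + v.2 * w.2

/-- The same scalar product, as a continuous bilinear map. -/
def lieInnerL (A : Matrix ι ι ℝ) (b : Module.Basis ι ℝ (ι → ℝ)) :
    AbelianExt A →L[ℝ] AbelianExt A →L[ℝ] ℝ :=
  LinearMap.toContinuousBilinearMap
    (LinearMap.mk₂ ℝ (fun v w : AbelianExt A => lieInner b v w)
      (fun v v' w => by
        have h1 : (v + v').1 = v.1 + v'.1 := rfl
        have h2 : (v + v').2 = v.2 + v'.2 := rfl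
        simp only [lieInner, h1, h2, map_add, Finsupp.add_apply, add_mul, Finset.sum_add_distrib]
        ring)
      (fun c v w => by
        have h1 : (c • v).1 = c • v.1 := rfl
        have h2 : (c • v).2 = c • v.2 := rfl
        simp only [lieInner, h1, h2, map_smul, Finsupp.smul_apply, smul_eq_mul, mul_add,
          Finset.mul_sum, mul_assoc])
      (fun v w w' => by
        have h1 : (w + w').1 = w.1 + w'.1 := rfl
        have h2 : (w + w').2 = w.2 + w'.2 := rfl
        simp only [lieInner, h1, h2, map_add, Finsupp.add_apply, mul_add, Finset.sum_add_distrib]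
        ring)
      (fun c v w => by
        have h1 : (c • w).1 = c • w.1 := rfl
        have h2 : (c • w).2 = c • w.2 := rfl
        simp only [lieInner, h1, h2, map_smul, Finsupp.smul_apply, smul_eq_mul, mul_add,
          Finset.mul_sum, mul_left_comm c]))

theorem dLeft_apply (p v : AbelianExt A) :
    dLeft p v = (NormedSpace.exp ((-p.2) • A) *ᵥ v.1, v.2) := by
  let L : AbelianExt A →ₗ[ℝ] AbelianExt A :=
    { toFun := fun v => (NormedSpace.exp ((-p.2) • A) *ᵥ v.1, v.2)
      map_add' := fun v w => Prod.ext (Matrix.mulVec_add _ v.1 w.1) rfl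
      map_smul' := fun c v => Prod.ext (Matrix.mulVec_smul _ c v.1) rfl }
  have h : HasFDerivAt (fun q : AbelianExt A => p⁻¹ + L.toContinuousLinearMap q)
      L.toContinuousLinearMap p :=
    L.toContinuousLinearMap.hasFDerivAt.const_add _
  have h' : (fun q : AbelianExt A => p⁻¹ * q) =
      fun q : AbelianExt A => p⁻¹ + L.toContinuousLinearMap q := rfl
  have h2 : dLeft p = L.toContinuousLinearMap := by
    unfold dLeft
    rw [h']
    exact h.fderiv
  rw [h2]
  rfl

theorem dLeft_injective (p : AbelianExt A) : Function.Injective (dLeft p) := by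
  intro v w h
  have h0 : ((NormedSpace.exp ((-p.2) • A) *ᵥ v.1, v.2) : (ι → ℝ) × ℝ) =
      (NormedSpace.exp ((-p.2) • A) *ᵥ w.1, w.2) :=
    (dLeft_apply p v).symm.trans (h.trans (dLeft_apply p w))
  have h1 := congrArg Prod.fst h0
  have h2 := congrArg Prod.snd h0
  refine Prod.ext ?_ h2
  have hu : IsUnit (NormedSpace.exp ((-p.2) • A)) := Matrix.isUnit_exp _
  exact Matrix.mulVec_injective_of_isUnit hu h1

theorem lieInner_pos (b : Module.Basis ι ℝ (ι → ℝ)) (v : AbelianExt A) (hv : v ≠ 0) :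
    0 < lieInner b v v := by
  have h1 : 0 ≤ ∑ i, b.repr v.1 i * b.repr v.1 i :=
    Finset.sum_nonneg fun i _ => mul_self_nonneg _
  have h2 : 0 ≤ v.2 * v.2 := mul_self_nonneg _
  refine lt_of_le_of_ne (add_nonneg h1 h2) fun h => hv ?_
  have h3 : ∑ i, b.repr v.1 i * b.repr v.1 i = 0 := by
    have : (∑ i, b.repr v.1 i * b.repr v.1 i) + v.2 * v.2 = 0 := h.symm
    linarith
  have h4 : v.2 * v.2 = 0 := by
    have : (∑ i, b.repr v.1 i * b.repr v.1 i) + v.2 * v.2 = 0 := h.symm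
    linarith
  rw [Finset.sum_eq_zero_iff_of_nonneg fun i _ => mul_self_nonneg _] at h3
  refine Prod.ext ?_ (mul_self_eq_zero.1 h4)
  apply b.repr.injective
  ext i
  rw [mul_self_eq_zero.1 (h3 i (Finset.mem_univ i))]
  exact (by simp : (0 : ℝ) = b.repr (0 : ι → ℝ) i)

theorem isBounded_lieInner (b : Module.Basis ι ℝ (ι → ℝ)) :
    Bornology.IsBounded {v : AbelianExt A | lieInner b v v < 1} := by
  let e : (ι → ℝ) ≃ₗ[ℝ] (ι → ℝ) := b.equivFun
  let c : (ι → ℝ) →L[ℝ] (ι → ℝ) := e.symm.toLinearMap.toContinuousLinearMap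
  have hball : Bornology.IsBounded (Metric.closedBall (0 : ι → ℝ) 1) := Metric.isBounded_closedBall
  have hK : Bornology.IsBounded
      ((c '' Metric.closedBall (0 : ι → ℝ) 1) ×ˢ Metric.closedBall (0 : ℝ) 1) :=
    (c.lipschitz.isBounded_image hball).prod Metric.isBounded_closedBall
  refine Bornology.IsBounded.subset (t := _) hK ?_
  intro v hv
  have hv' : (∑ i, b.repr v.1 i * b.repr v.1 i) + v.2 * v.2 < 1 := hv
  have h1 : 0 ≤ ∑ i, b.repr v.1 i * b.repr v.1 i :=
    Finset.sum_nonneg fun i _ => mul_self_nonneg _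
  refine ⟨⟨e v.1, ?_, e.symm_apply_apply v.1⟩, ?_⟩
  · rw [mem_closedBall_zero_iff, pi_norm_le_iff_of_nonneg zero_le_one]
    intro i
    have h2 := Finset.single_le_sum (f := fun i => b.repr v.1 i * b.repr v.1 i)
      (fun i _ => mul_self_nonneg _) (Finset.mem_univ i)
    have h3 : e v.1 i = b.repr v.1 i := rfl
    rw [h3, Real.norm_eq_abs]
    refine abs_le_one_iff_mul_self_le_one.2 ?_
    nlinarith [mul_self_nonneg v.2]
  · rw [mem_closedBall_zero_iff, Real.norm_eq_abs]
    refine abs_le_one_iff_mul_self_le_one.2 ?_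
    linarith

variable (A) in
/-- The left-invariant Riemannian metric on `G(A)` whose value at the identity is the scalar product
for which `(b i, 0)`, `i : ι`, and `(0, 1)` are orthonormal. -/
def leftInvariantMetric (b : Module.Basis ι ℝ (ι → ℝ)) :
    Bundle.RiemannianMetric
      (fun p : AbelianExt A => TangentSpace 𝓘(ℝ, AbelianExt A) p) where
  inner p := ((lieInnerL A b).bilinearComp (dLeft p) (dLeft p) :
    AbelianExt A →L[ℝ] AbelianExt A →L[ℝ] ℝ)
  symm p v w := by
    change lieInner b (dLeft p v) (dLeft p w) = lieInner b (dLeft p w) (dLeft p v)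
    simp only [lieInner, mul_comm]
  pos p v hv := by
    change 0 < lieInner b (dLeft p v) (dLeft p v)
    refine lieInner_pos b _ fun h => hv ?_
    exact dLeft_injective p (h.trans (map_zero (dLeft p)).symm)
  continuousAt p := by
    change ContinuousAt (fun v : AbelianExt A =>
      (lieInnerL A b).bilinearComp (dLeft p) (dLeft p) v v) 0
    fun_prop
  isVonNBounded p := by
    change Bornology.IsVonNBounded ℝ
      {v : AbelianExt A | lieInner b (dLeft p v) (dLeft p v) < 1}
    rw [NormedSpace.isVonNBounded_iff]
    obtain ⟨K, -, hK⟩ := (dLeft p).toLinearMap.exists_antilipschitzWith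
      (LinearMap.ker_eq_bot.2 (dLeft_injective p))
    exact hK.isBounded_preimage (isBounded_lieInner b)

/-- The coordinate frame of `ℝ^ι × ℝ`. -/
def coordFrame (A : Matrix ι ι ℝ) : Option ι → AbelianExt A
  | some i => (Pi.single i 1, 0)
  | none => (0, 1)

section Riemannian

variable (g : Bundle.RiemannianMetric
  (fun p : AbelianExt A => TangentSpace 𝓘(ℝ, AbelianExt A) p))

/-- The Riemannian distance of `g` (the infimum of the lengths of `C^1` paths). -/
def gDist (p q : AbelianExt A) : ℝ≥0∞ :=
  letI : Bundle.RiemannianBundle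
    (fun p : AbelianExt A => TangentSpace 𝓘(ℝ, AbelianExt A) p) := ⟨g⟩
  riemannianEDist 𝓘(ℝ, AbelianExt A) p q

/-- The open geodesic ball of `g` with centre `p` and radius `r`. -/
def gBall (p : AbelianExt A) (r : ℝ) : Set (AbelianExt A) :=
  {q | gDist g p q < ENNReal.ofReal r}

/-- The Gram matrix `(g_{ij}(p))` of `g` at `p` in the global coordinates. -/
def gram (p : AbelianExt A) : Matrix (Option ι) (Option ι) ℝ :=
  Matrix.of fun i j => g.inner p (coordFrame A i) (coordFrame A j)

/-- The Riemannian volume `√(det g_{ij}) dx`. -/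
def gVol : Measure (AbelianExt A) :=
  volume.withDensity fun p => ENNReal.ofReal (Real.sqrt (gram g p).det)

/-- `g` has volume entropy `δ`: geodesic balls have finite volume, and
`log Vol(B(p, r)) / r → δ` as `r → ∞`, for every base point `p`. -/
def HasVolumeEntropy (δ : ℝ) : Prop :=
  ∀ p : AbelianExt A, (∀ r : ℝ, gVol g (gBall g p r) ≠ ⊤) ∧
    Tendsto (fun r : ℝ => Real.log (gVol g (gBall g p r)).toReal / r) atTop (𝓝 δ)

end Riemannian

end AbelianExt

section Matrices

variable {ι : Type*} [Fintype ι] [DecidableEq ι]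

/-- `A` is diagonalizable over `ℂ`. -/
def IsDiagonalizableOverC (A : Matrix ι ι ℝ) : Prop :=
  ∃ (S : (Matrix ι ι ℂ)ˣ) (d : ι → ℂ),
    A.map Complex.ofReal =
      (S : Matrix ι ι ℂ) * Matrix.diagonal d * ((S⁻¹ : (Matrix ι ι ℂ)ˣ) : Matrix ι ι ℂ)

/-- Every complex eigenvalue of `A` has positive real part, i.e. `G(A)` is an
abelian Heintze group. -/
def IsHeintze (A : Matrix ι ι ℝ) : Prop :=
  ∀ z ∈ spectrum ℂ (A.map Complex.ofReal), 0 < z.re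

/-- `J` is in (semisimple) real Jordan form: up to the numbering of the rows and columns it is
block diagonal, with blocks `(a)` of size one and blocks `(α, -β; β, α)` of size two. -/
def IsRealJordanForm (J : Matrix ι ι ℝ) : Prop :=
  ∃ (k l : ℕ) (e : Fin k ⊕ Fin 2 × Fin l ≃ ι) (a : Fin k → ℝ) (α β : Fin l → ℝ),
    J.submatrix e e = Matrix.fromBlocks (Matrix.diagonal a) 0 0
      (Matrix.blockDiagonal fun j => !![α j, -β j; β j, α j])

/-- The matrix of `x ↦ A x` in the basis `b` is in (semisimple) real Jordan form. -/
def IsJordanBasis (A : Matrix ι ι ℝ) (b : Module.Basis ι ℝ (ι → ℝ)) : Prop :=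
  IsRealJordanForm (LinearMap.toMatrix b b (Matrix.toLin' A))

end Matrices

/-- The block-diagonal matrix `diag(A, -B)`; the horospherical product of `G(A)` and `G(B)` is
`AbelianExt (horoMatrix A B) = (ℝ^m × ℝ^n) ⋊ ℝ`. -/
def horoMatrix {m n : ℕ} (A : Matrix (Fin m) (Fin m) ℝ) (B : Matrix (Fin n) (Fin n) ℝ) :
    Matrix (Fin m ⊕ Fin n) (Fin m ⊕ Fin n) ℝ :=
  Matrix.fromBlocks A 0 0 (-B)

end

/-!
# Volume entropy of `ℝ^k ⋊ ℝ` and of horospherical products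

In a Jordan basis of `M` the left-invariant metric of `G(M)` is diagonal: a real Jordan form `J` is
normal and `J + Jᵀ` is diagonal, so `exp (-tJ)ᵀ exp (-tJ) = exp (-t (J + Jᵀ))` and the metric is
`∑ exp (-2 t l i) dx i ^ 2 + dt ^ 2`, where the `l i` are the real parts of the eigenvalues
(`AbelianExt.leftInvariantMetric_inner`).  The entropy of such a metric is
`(∑ |l i| + |∑ l i|) / 2 = max (∑ max (l i) 0) (∑ max (-l i) 0)`
(`AbelianExt.hasVolumeEntropy_growthRate`), by the following two bounds.

* A path of length less than `r` from the origin to `(x, t)` has its height in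
  `[(t - r) / 2, (t + r) / 2]`, so its `i`-th coordinate moves at most
  `r * exp ((l i * t + |l i| * r) / 2)`.  By Fubini the ball lies in a set of volume at most
  `(2 r) ^ (k + 1) * exp (r * (∑ |l i| + |∑ l i|) / 2)`.
* The point `(x, t)` with `|x i| ≤ max 1 (exp (t * l i))` is within `2 k + |t|` of the origin: the
  coordinates with `|x i| ≤ 1` are moved at height `0` and the others at height `t`.  For `t` near
  `r` or near `-r`, according to the sign of `∑ l i`, these points fill the volume required.

If all eigenvalues of `A` and `B` have positive real part, then `∑ |l i|` and `∑ l i`, read off the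
characteristic polynomial over `ℂ`, are both `tr A` for `A`, and are `tr A + tr B` and
`tr A - tr B` for `diag(A, -B)`.

A Jordan basis of a matrix diagonalizable over `ℂ` is extracted from the real and imaginary parts of
the complex eigenvectors: each pair spans an invariant line or plane, and these are added one at a
time to an independent system (`HasJordanSystem.exists_mem_of_plane`).
-/

/-! ### The Riemannian distance through paths in coordinates -/

namespace AbelianExt

section Paths

variable {ι : Type*} [Fintype ι] [DecidableEq ι] {A : Matrix ι ι ℝ}
  (g : Bundle.RiemannianMetric
    (fun p : AbelianExt A => TangentSpace 𝓘(ℝ, AbelianExt A) p))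

/-- The norm of the tangent vector `v` at `p`, for the Riemannian metric `g`, in coordinates. -/
noncomputable def gNorm (p v : AbelianExt A) : ℝ := Real.sqrt (g.inner p v v)

theorem enorm_tangent_eq (p : AbelianExt A) (v : TangentSpace 𝓘(ℝ, AbelianExt A) p) :
    (letI : Bundle.RiemannianBundle
      (fun p : AbelianExt A => TangentSpace 𝓘(ℝ, AbelianExt A) p) := ⟨g⟩
    ‖v‖ₑ) = ENNReal.ofReal (gNorm g p v) := by
  let : Bundle.RiemannianBundle
      (fun p : AbelianExt A => TangentSpace 𝓘(ℝ, AbelianExt A) p) := ⟨g⟩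
  change ‖v‖ₑ = _
  rw [← ofReal_norm, norm_eq_sqrt_real_inner]
  rfl

theorem pathELength_eq_lintegral_gNorm (γ : ℝ → AbelianExt A) :
    (letI : Bundle.RiemannianBundle
      (fun p : AbelianExt A => TangentSpace 𝓘(ℝ, AbelianExt A) p) := ⟨g⟩
    pathELength 𝓘(ℝ, AbelianExt A) γ 0 1) =
    ∫⁻ s in Set.Icc (0 : ℝ) 1, ENNReal.ofReal (gNorm g (γ s) (derivWithin γ (Set.Icc 0 1) s)) := by
  let : Bundle.RiemannianBundle
      (fun p : AbelianExt A => TangentSpace 𝓘(ℝ, AbelianExt A) p) := ⟨g⟩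
  change pathELength 𝓘(ℝ, AbelianExt A) γ 0 1 = _
  rw [pathELength_eq_lintegral_mfderivWithin_Icc]
  refine lintegral_congr fun s => ?_
  rw [mfderivWithin_eq_fderivWithin]
  exact enorm_tangent_eq g (γ s) _

theorem exists_path_of_gDist_lt {p q : AbelianExt A} {r : ℝ≥0∞} (h : gDist g p q < r) :
    ∃ γ : ℝ → AbelianExt A, γ 0 = p ∧ γ 1 = q ∧ ContDiffOn ℝ 1 γ (Set.Icc 0 1) ∧
      ∫⁻ s in Set.Icc (0 : ℝ) 1,
        ENNReal.ofReal (gNorm g (γ s) (derivWithin γ (Set.Icc 0 1) s)) < r := by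
  let : Bundle.RiemannianBundle
      (fun p : AbelianExt A => TangentSpace 𝓘(ℝ, AbelianExt A) p) := ⟨g⟩
  obtain ⟨γ, h0, h1, hγ, hl⟩ := exists_lt_of_riemannianEDist_lt (I := 𝓘(ℝ, AbelianExt A)) h
  refine ⟨γ, h0, h1, contMDiffOn_iff_contDiffOn.1 hγ, ?_⟩
  rw [← pathELength_eq_lintegral_gNorm]
  exact hl

theorem gDist_le_lintegral {γ : ℝ → AbelianExt A} (hγ : ContDiff ℝ 1 γ) :
    gDist g (γ 0) (γ 1) ≤ ∫⁻ s in Set.Icc (0 : ℝ) 1,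
        ENNReal.ofReal (gNorm g (γ s) (derivWithin γ (Set.Icc 0 1) s)) := by
  let : Bundle.RiemannianBundle
      (fun p : AbelianExt A => TangentSpace 𝓘(ℝ, AbelianExt A) p) := ⟨g⟩
  rw [← pathELength_eq_lintegral_gNorm]
  exact riemannianEDist_le_pathELength (I := 𝓘(ℝ, AbelianExt A))
    (contMDiffOn_iff_contDiffOn.2 hγ.contDiffOn) rfl rfl zero_le_one

theorem gDist_triangle (p q r : AbelianExt A) : gDist g p r ≤ gDist g p q + gDist g q r := by
  let : Bundle.RiemannianBundle
      (fun p : AbelianExt A => TangentSpace 𝓘(ℝ, AbelianExt A) p) := ⟨g⟩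
  exact riemannianEDist_triangle (I := 𝓘(ℝ, AbelianExt A))

end Paths

end AbelianExt

/-! ### The metric in a Jordan basis -/

/-- A real Jordan form is a normal matrix. -/
theorem IsRealJordanForm.commute_transpose {ι : Type*} [Fintype ι] [DecidableEq ι]
    {J : Matrix ι ι ℝ} (hJ : IsRealJordanForm J) : Commute J Jᵀ := by
  obtain ⟨k, l, e, a, α, β, h⟩ := hJ
  have h2 : ∀ x y : ℝ, !![x, -y; y, x] * !![x, -y; y, x]ᵀ = !![x, -y; y, x]ᵀ * !![x, -y; y, x] := by
    intro x y
    ext i j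
    fin_cases i <;> fin_cases j <;> simp [Matrix.mul_apply, Fin.sum_univ_two] <;> ring
  have h3 : (J * Jᵀ).submatrix e e = (Jᵀ * J).submatrix e e := by
    rw [← Matrix.submatrix_mul_equiv _ _ _ e, ← Matrix.submatrix_mul_equiv _ _ _ e,
      ← Matrix.transpose_submatrix, h]
    simp only [Matrix.fromBlocks_transpose, Matrix.fromBlocks_multiply,
      Matrix.blockDiagonal_transpose, ← Matrix.blockDiagonal_mul, h2,
      Matrix.diagonal_transpose, Matrix.transpose_zero, Matrix.mul_zero, Matrix.zero_mul,
      add_zero, zero_add]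
  ext i j
  simpa using congrFun (congrFun h3 (e.symm i)) (e.symm j)

theorem IsRealJordanForm.add_transpose {ι : Type*} [Fintype ι] [DecidableEq ι]
    {J : Matrix ι ι ℝ} (hJ : IsRealJordanForm J) :
    J + Jᵀ = Matrix.diagonal fun i => 2 * J i i := by
  obtain ⟨k, l, e, a, α, β, h⟩ := hJ
  have h0 : ∀ i j, J i j = J.submatrix e e (e.symm i) (e.symm j) := by simp
  ext i j
  rw [Matrix.add_apply, Matrix.transpose_apply, Matrix.diagonal_apply, h0 i j, h0 j i, h0 i i, h]
  have hij : i = j ↔ e.symm i = e.symm j := by simp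
  rw [if_congr hij rfl rfl]
  generalize e.symm i = i'
  generalize e.symm j = j'
  rcases i' with i' | ⟨i', i''⟩ <;> rcases j' with j' | ⟨j', j''⟩
  · by_cases hh : i' = j'
    · subst hh; simp; ring
    · simp [hh, Ne.symm hh]
  · simp
  · simp
  · by_cases hh : i'' = j''
    · subst hh
      fin_cases i' <;> fin_cases j' <;> simp [Matrix.blockDiagonal_apply] <;> ring
    · simp [Matrix.blockDiagonal_apply, hh, Ne.symm hh]

/-- In an orthonormal basis putting `M` in real Jordan form, `exp (t M)` scales lengths as the
diagonal matrix of the real parts of the eigenvalues: the form is normal, so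
`exp (tJ)ᵀ exp (tJ) = exp (t (J + Jᵀ))`. -/
theorem IsRealJordanForm.exp_transpose_mul_exp {ι : Type*} [Fintype ι] [DecidableEq ι]
    {J : Matrix ι ι ℝ} (hJ : IsRealJordanForm J) (t : ℝ) :
    (NormedSpace.exp (t • J))ᵀ * NormedSpace.exp (t • J) =
      Matrix.diagonal fun i => Real.exp (2 * t * J i i) := by
  rw [← Matrix.exp_transpose, Matrix.transpose_smul, ← Matrix.exp_add_of_commute _ _
    ((hJ.commute_transpose.symm.smul_left t).smul_right t), ← smul_add, add_comm,
    hJ.add_transpose, ← Matrix.diagonal_smul, Matrix.exp_diagonal]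
  congr 1
  ext i
  rw [Pi.coe_exp, ← Real.exp_eq_exp_ℝ]
  simp only [Pi.smul_apply, smul_eq_mul]
  ring_nf

/-- Conjugating by the change of basis, `exp (t M)` acts on coordinates in `b` as the exponential of
the matrix of `M` in `b`. -/
theorem repr_exp_mulVec {ι : Type*} [Fintype ι] [DecidableEq ι] (M : Matrix ι ι ℝ)
    (b : Module.Basis ι ℝ (ι → ℝ)) (t : ℝ) (x : ι → ℝ) :
    (b.repr (NormedSpace.exp (t • M) *ᵥ x) : ι → ℝ) =
      NormedSpace.exp (t • LinearMap.toMatrix b b (Matrix.toLin' M)) *ᵥ (b.repr x : ι → ℝ) := by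
  let e : (ι → ℝ) ≃ₗ[ℝ] (ι → ℝ) := b.equivFun
  let U : (Matrix ι ι ℝ)ˣ :=
    { val := LinearMap.toMatrix' (e : (ι → ℝ) →ₗ[ℝ] (ι → ℝ))
      inv := LinearMap.toMatrix' (e.symm : (ι → ℝ) →ₗ[ℝ] (ι → ℝ))
      val_inv := by rw [← LinearMap.toMatrix'_comp]; simp
      inv_val := by rw [← LinearMap.toMatrix'_comp]; simp }
  have hU : ∀ y, (U : Matrix ι ι ℝ) *ᵥ y = b.repr y := fun y => LinearMap.toMatrix'_mulVec _ _
  have h1 : LinearMap.toMatrix b b (Matrix.toLin' M) =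
      (U : Matrix ι ι ℝ) * M * ((U⁻¹ : (Matrix ι ι ℝ)ˣ) : Matrix ι ι ℝ) := by
    have h2 : (U : Matrix ι ι ℝ) * M * ((U⁻¹ : (Matrix ι ι ℝ)ˣ) : Matrix ι ι ℝ) =
        LinearMap.toMatrix' ((e : (ι → ℝ) →ₗ[ℝ] (ι → ℝ)) ∘ₗ Matrix.toLin' M ∘ₗ
          (e.symm : (ι → ℝ) →ₗ[ℝ] (ι → ℝ))) := by
      rw [LinearMap.toMatrix'_comp, LinearMap.toMatrix'_comp, LinearMap.toMatrix'_toLin',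
        ← Matrix.mul_assoc]
      rfl
    rw [h2]
    ext i j
    simp [LinearMap.toMatrix_apply, LinearMap.toMatrix'_apply, e]
  have h2 : t • (U * M * ((U⁻¹ : (Matrix ι ι ℝ)ˣ) : Matrix ι ι ℝ)) =
      U * (t • M) * ((U⁻¹ : (Matrix ι ι ℝ)ˣ) : Matrix ι ι ℝ) := by simp
  rw [h1, h2, Matrix.exp_units_conj, ← hU, ← hU, Matrix.mulVec_mulVec, Matrix.mulVec_mulVec,
    Units.inv_mul_cancel_right]

/-- The diagonal entries of the matrix of `M` in the basis `b`.  For a Jordan basis these are the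
real parts of the eigenvalues of `M`, with multiplicity. -/
noncomputable def diagWeight {ι : Type*} [Fintype ι] [DecidableEq ι] (M : Matrix ι ι ℝ)
    (b : Module.Basis ι ℝ (ι → ℝ)) (i : ι) : ℝ :=
  LinearMap.toMatrix b b (Matrix.toLin' M) i i

namespace AbelianExt

variable {ι : Type*} [Fintype ι] [DecidableEq ι] {A : Matrix ι ι ℝ}
  {b : Module.Basis ι ℝ (ι → ℝ)}

/-- In a Jordan basis the left-invariant metric is diagonal: the rotational parts of the
`2 × 2` blocks do not contribute. -/
theorem leftInvariantMetric_inner (hb : IsJordanBasis A b) (p v w : AbelianExt A) :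
    (leftInvariantMetric A b).inner p v w =
      (∑ i, Real.exp (-(2 * p.2 * diagWeight A b i)) * (b.repr v.1 i * b.repr w.1 i)) +
        v.2 * w.2 := by
  change lieInner b (dLeft p v) (dLeft p w) = _
  rw [dLeft_apply, dLeft_apply]
  unfold lieInner
  congr 1
  simp only [repr_exp_mulVec]
  have h := hb.exp_transpose_mul_exp (-p.2)
  set E := NormedSpace.exp (-p.2 • LinearMap.toMatrix b b (Matrix.toLin' A))
  change (E *ᵥ _) ⬝ᵥ (E *ᵥ _) = _
  rw [Matrix.dotProduct_mulVec, ← Matrix.mulVec_transpose, Matrix.mulVec_mulVec, h]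
  simp only [dotProduct, Matrix.mulVec_diagonal]
  refine Finset.sum_congr rfl fun i _ => ?_
  rw [diagWeight, mul_assoc]
  congr 2
  ring

theorem gNorm_leftInvariantMetric (hb : IsJordanBasis A b) (p v : AbelianExt A) :
    gNorm (leftInvariantMetric A b) p v =
      Real.sqrt ((∑ i, (Real.exp (-(p.2 * diagWeight A b i)) * b.repr v.1 i) ^ 2) + v.2 ^ 2) := by
  rw [gNorm, leftInvariantMetric_inner hb, sq v.2]
  congr 2
  refine Finset.sum_congr rfl fun i _ => ?_
  rw [mul_pow, ← Real.exp_nat_mul, sq (b.repr v.1 i)]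
  congr 2
  push_cast
  ring

theorem abs_snd_le_gNorm (hb : IsJordanBasis A b) (p v : AbelianExt A) :
    |v.2| ≤ gNorm (leftInvariantMetric A b) p v := by
  rw [gNorm_leftInvariantMetric hb]
  refine Real.abs_le_sqrt (le_add_of_nonneg_left (Finset.sum_nonneg fun i _ => sq_nonneg _))

/-- At height `p.2`, the `i`-th horizontal coordinate moves at most `exp (p.2 * l i)` times as fast
as the path. -/
theorem abs_repr_le_gNorm (hb : IsJordanBasis A b) (p v : AbelianExt A) (i : ι) :
    |b.repr v.1 i| ≤
      Real.exp (p.2 * diagWeight A b i) * gNorm (leftInvariantMetric A b) p v := by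
  have h : |Real.exp (-(p.2 * diagWeight A b i)) * b.repr v.1 i| ≤
      gNorm (leftInvariantMetric A b) p v := by
    rw [gNorm_leftInvariantMetric hb]
    refine Real.abs_le_sqrt (le_add_of_le_of_nonneg ?_ (sq_nonneg _))
    exact Finset.single_le_sum
      (f := fun i => (Real.exp (-(p.2 * diagWeight A b i)) * b.repr v.1 i) ^ 2)
      (fun i _ => sq_nonneg _) (Finset.mem_univ i)
  rw [abs_mul, Real.abs_exp, Real.exp_neg, inv_mul_le_iff₀ (Real.exp_pos _)] at h
  exact h

theorem gNorm_le (hb : IsJordanBasis A b) (p v : AbelianExt A) :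
    gNorm (leftInvariantMetric A b) p v ≤
      (∑ i, Real.exp (-(p.2 * diagWeight A b i)) * |b.repr v.1 i|) + |v.2| := by
  rw [gNorm_leftInvariantMetric hb]
  have h0 : ∀ i, 0 ≤ Real.exp (-(p.2 * diagWeight A b i)) * |b.repr v.1 i| := fun i => by positivity
  have h1 : 0 ≤ ∑ i, Real.exp (-(p.2 * diagWeight A b i)) * |b.repr v.1 i| :=
    Finset.sum_nonneg fun i _ => h0 i
  refine Real.sqrt_le_iff.2 ⟨by positivity, ?_⟩
  have h2 := Finset.sum_sq_le_sq_sum_of_nonneg (s := Finset.univ) fun i _ => h0 i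
  simp only [mul_pow, sq_abs] at h2 ⊢
  nlinarith [mul_nonneg h1 (abs_nonneg v.2), sq_abs v.2]

theorem gram_leftInvariantMetric_det (hb : IsJordanBasis A b) (p : AbelianExt A) :
    Real.sqrt (gram (leftInvariantMetric A b) p).det =
      |(LinearMap.toMatrix' (b.equivFun : (ι → ℝ) →ₗ[ℝ] (ι → ℝ))).det| *
        Real.exp (-(p.2 * ∑ i, diagWeight A b i)) := by
  set P := LinearMap.toMatrix' (b.equivFun : (ι → ℝ) →ₗ[ℝ] (ι → ℝ)) with hP
  set D := Matrix.diagonal fun i => Real.exp (-(2 * p.2 * diagWeight A b i)) with hD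
  -- The Gram matrix is block diagonal, with blocks `Pᵀ * D * P` and `1`.
  have h1 : gram (leftInvariantMetric A b) p =
      (Matrix.fromBlocks (Pᵀ * D * P) 0 0 (1 : Matrix Unit Unit ℝ)).submatrix
        (Equiv.optionEquivSumPUnit ι) (Equiv.optionEquivSumPUnit ι) := by
    have hPk : ∀ k i, P k i = b.repr (Pi.single i 1) k := fun k i => by
      rw [hP, LinearMap.toMatrix'_apply]; rfl
    ext i j
    rw [gram, Matrix.of_apply, leftInvariantMetric_inner hb]
    rcases i with _ | i <;> rcases j with _ | j
    · simp [coordFrame]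
    · simp [coordFrame]
    · simp [coordFrame]
    · simp only [coordFrame, Matrix.submatrix_apply, Equiv.optionEquivSumPUnit_some,
        Matrix.fromBlocks_apply₁₁, mul_zero, add_zero]
      rw [Matrix.mul_apply]
      simp only [hD, Matrix.mul_diagonal, Matrix.transpose_apply, hPk]
      exact Finset.sum_congr rfl fun k _ => by ring
  rw [h1, Matrix.det_submatrix_equiv_self, Matrix.det_fromBlocks_zero₁₂, Matrix.det_one, mul_one,
    Matrix.det_mul, Matrix.det_mul, Matrix.det_transpose, hD, Matrix.det_diagonal,
    ← Real.exp_sum]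
  have h2 : Real.exp (∑ i, -(2 * p.2 * diagWeight A b i)) =
      Real.exp (-(p.2 * ∑ i, diagWeight A b i)) ^ 2 := by
    rw [← Real.exp_nat_mul, Finset.sum_neg_distrib, ← Finset.mul_sum]
    congr 1
    push_cast
    ring
  rw [h2, show ∀ x y : ℝ, x * y ^ 2 * x = (x * y) ^ 2 by intros; ring, Real.sqrt_sq_eq_abs, abs_mul,
    Real.abs_exp]

end AbelianExt

/-! ### Estimates of distances, and volumes of boxes -/

namespace AbelianExt

variable {ι : Type*} [Fintype ι] [DecidableEq ι] {A : Matrix ι ι ℝ}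
  {b : Module.Basis ι ℝ (ι → ℝ)}

theorem enorm_map_sub_le_lintegral {E : Type*} [NormedAddCommGroup E] [NormedSpace ℝ E]
    {γ : ℝ → E} (hγ : ContDiffOn ℝ 1 γ (Set.Icc 0 1)) (φ : E →L[ℝ] ℝ) {a c : ℝ}
    (ha : 0 ≤ a) (hac : a ≤ c) (hc : c ≤ 1) :
    ‖φ (γ c) - φ (γ a)‖ₑ ≤ ∫⁻ s in Set.Icc a c, ‖φ (derivWithin γ (Set.Icc 0 1) s)‖ₑ := by
  have h1 : ContDiffOn ℝ 1 (fun s => φ (γ s)) (Set.Icc a c) :=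
    φ.contDiff.comp_contDiffOn (hγ.mono (Set.Icc_subset_Icc ha hc))
  refine (enorm_sub_le_lintegral_deriv_of_contDiffOn_Icc h1 hac).trans_eq ?_
  rw [← restrict_Ioo_eq_restrict_Icc]
  refine setLIntegral_congr_fun measurableSet_Ioo fun s hs => ?_
  have hs' : Set.Icc (0 : ℝ) 1 ∈ 𝓝 s := Icc_mem_nhds (ha.trans_lt hs.1) (hs.2.trans_le hc)
  have hd : HasDerivAt γ (derivWithin γ (Set.Icc 0 1) s) s :=
    ((hγ.differentiableOn one_ne_zero s (mem_of_mem_nhds hs')).hasDerivWithinAt).hasDerivAt hs'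
  have h2 : HasDerivAt (fun s => φ (γ s)) (φ (derivWithin γ (Set.Icc 0 1) s)) s :=
    φ.hasFDerivAt.comp_hasDerivAt s hd
  rw [h2.deriv]

/-- The height coordinate `(x, t) ↦ t`, as a linear form. -/
noncomputable def heightL (A : Matrix ι ι ℝ) : AbelianExt A →L[ℝ] ℝ :=
  LinearMap.toContinuousLinearMap
    { toFun := fun v => v.2, map_add' := fun _ _ => rfl, map_smul' := fun _ _ => rfl }

/-- The `i`-th horizontal coordinate of `(x, t)` in the basis `b`, as a linear form. -/
noncomputable def coordL (A : Matrix ι ι ℝ) (b : Module.Basis ι ℝ (ι → ℝ)) (i : ι) : AbelianExt A →L[ℝ] ℝ :=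
  LinearMap.toContinuousLinearMap
    { toFun := fun v => b.repr v.1 i
      map_add' := fun v w => by
        change b.repr (v.1 + w.1) i = _
        simp
      map_smul' := fun c v => by
        change b.repr (c • v.1) i = _
        simp }

theorem coordL_apply (i : ι) (v : AbelianExt A) : coordL A b i v = b.repr v.1 i := rfl

theorem heightL_apply (v : AbelianExt A) : heightL A v = v.2 := rfl

/-- A path of length less than `r` from `p` to `q` stays at heights between
`(p.2 + q.2 - r) / 2` and `(p.2 + q.2 + r) / 2`, which bounds the speed of its horizontal
coordinates. -/
theorem bounds_of_gDist_lt (hb : IsJordanBasis A b) {p q : AbelianExt A} {r : ℝ}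
    (h : gDist (leftInvariantMetric A b) p q < ENNReal.ofReal r) :
    |q.2 - p.2| ≤ r ∧ ∀ i, |b.repr q.1 i - b.repr p.1 i| ≤
      r * Real.exp ((diagWeight A b i * (p.2 + q.2) + |diagWeight A b i| * r) / 2) := by
  have hr : 0 < r := ENNReal.ofReal_pos.1 (bot_le.trans_lt h)
  obtain ⟨γ, rfl, rfl, hγ, hl⟩ := exists_path_of_gDist_lt _ h
  set N : ℝ → ℝ := fun s =>
    gNorm (leftInvariantMetric A b) (γ s) (derivWithin γ (Set.Icc 0 1) s) with hN
  have hN0 : ∀ s, 0 ≤ N s := fun s => Real.sqrt_nonneg _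
  have hv : ∀ a c : ℝ, 0 ≤ a → a ≤ c → c ≤ 1 →
      ENNReal.ofReal |(γ c).2 - (γ a).2| ≤ ∫⁻ s in Set.Icc a c, ENNReal.ofReal (N s) := by
    intro a c ha hac hc
    have h1 := enorm_map_sub_le_lintegral hγ (heightL A) ha hac hc
    simp only [heightL_apply, Real.enorm_eq_ofReal_abs] at h1
    refine h1.trans (lintegral_mono fun s => ENNReal.ofReal_le_ofReal ?_)
    exact abs_snd_le_gNorm hb _ _
  have hheight : ∀ s ∈ Set.Icc (0 : ℝ) 1, |(γ s).2 - (γ 0).2| + |(γ 1).2 - (γ s).2| ≤ r := by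
    intro s hs
    have h1 := add_le_add (hv 0 s le_rfl hs.1 hs.2) (hv s 1 hs.1 hs.2 le_rfl)
    rw [← restrict_Ioc_eq_restrict_Icc (a := s), ← lintegral_union measurableSet_Ioc,
      Set.Icc_union_Ioc_eq_Icc hs.1 hs.2, ← ENNReal.ofReal_add (abs_nonneg _) (abs_nonneg _)] at h1
    · exact (ENNReal.ofReal_le_ofReal_iff hr.le).1 (h1.trans hl.le)
    · exact Set.disjoint_left.2 fun x hx hx' => hx'.1.not_ge hx.2
  refine ⟨?_, fun i => ?_⟩
  · simpa using hheight 1 (by simp)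
  · set lam := diagWeight A b i
    set C := Real.exp ((lam * ((γ 0).2 + (γ 1).2) + |lam| * r) / 2) with hC
    have h1 := enorm_map_sub_le_lintegral hγ (coordL A b i) le_rfl zero_le_one le_rfl
    simp only [coordL_apply, Real.enorm_eq_ofReal_abs] at h1
    rw [← ENNReal.ofReal_le_ofReal_iff (by positivity)]
    refine h1.trans ?_
    calc ∫⁻ s in Set.Icc (0 : ℝ) 1,
          ENNReal.ofReal |b.repr (derivWithin γ (Set.Icc 0 1) s).1 i|
        ≤ ∫⁻ s in Set.Icc (0 : ℝ) 1, ENNReal.ofReal C * ENNReal.ofReal (N s) := by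
          refine setLIntegral_mono' measurableSet_Icc fun s hs => ?_
          rw [← ENNReal.ofReal_mul (Real.exp_nonneg _)]
          refine ENNReal.ofReal_le_ofReal ((abs_repr_le_gNorm hb (γ s) _ i).trans ?_)
          refine mul_le_mul_of_nonneg_right (Real.exp_le_exp.2 ?_) (hN0 s)
          have h2 : lam * (((γ s).2 - (γ 0).2) - ((γ 1).2 - (γ s).2)) ≤ |lam| * r := by
            refine (le_abs_self _).trans ?_
            rw [abs_mul]
            exact mul_le_mul_of_nonneg_left ((abs_sub _ _).trans (hheight s hs)) (abs_nonneg _)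
          change (γ s).2 * lam ≤ _
          linarith
      _ = ENNReal.ofReal C * ∫⁻ s in Set.Icc (0 : ℝ) 1, ENNReal.ofReal (N s) :=
          lintegral_const_mul' _ _ ENNReal.ofReal_ne_top
      _ ≤ ENNReal.ofReal (r * C) := by
          rw [mul_comm r, ENNReal.ofReal_mul (Real.exp_nonneg _)]
          gcongr

theorem gDist_add_le (g : Bundle.RiemannianMetric
      (fun p : AbelianExt A => TangentSpace 𝓘(ℝ, AbelianExt A) p)) (p v : AbelianExt A) {C : ℝ}
    (h : ∀ s ∈ Set.Icc (0 : ℝ) 1, gNorm g (p + s • v) v ≤ C) :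
    gDist g p (p + v) ≤ ENNReal.ofReal C := by
  have hd : ∀ s, HasDerivAt (fun s : ℝ => p + s • v) v s := fun s => by
    simpa using ((hasDerivAt_id s).smul_const v).const_add p
  have h1 := gDist_le_lintegral g (γ := fun s : ℝ => p + s • v)
    (contDiff_const.add (contDiff_id.smul contDiff_const))
  simp only [zero_smul, add_zero, one_smul] at h1
  refine h1.trans ?_
  calc _ ≤ ∫⁻ _ in Set.Icc (0 : ℝ) 1, ENNReal.ofReal C := by
        refine setLIntegral_mono' measurableSet_Icc fun s hs => ENNReal.ofReal_le_ofReal ?_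
        rw [(hd s).hasDerivWithinAt.derivWithin (uniqueDiffOn_Icc zero_lt_one s hs)]
        exact h s hs
    _ = ENNReal.ofReal C := by simp

/-- The horizontal segment of displacement `y` at height `t` is a path of constant speed. -/
theorem gDist_horizontal_le (hb : IsJordanBasis A b) (x y : ι → ℝ) (t : ℝ) :
    gDist (leftInvariantMetric A b) ((x, t) : (ι → ℝ) × ℝ) ((x + y, t) : (ι → ℝ) × ℝ) ≤
      ENNReal.ofReal (∑ i, Real.exp (-(t * diagWeight A b i)) * |b.repr y i|) := by
  have h := gDist_add_le (leftInvariantMetric A b) ((x, t) : (ι → ℝ) × ℝ) ((y, 0) : (ι → ℝ) × ℝ)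
    (C := ∑ i, Real.exp (-(t * diagWeight A b i)) * |b.repr y i|) fun s _ => by
      refine (gNorm_le hb _ _).trans_eq ?_
      have h2 : t + s • (0 : ℝ) = t := by simp
      change (∑ i, Real.exp (-((t + s • (0 : ℝ)) * diagWeight A b i)) * |b.repr y i|) + |(0 : ℝ)| = _
      rw [h2, abs_zero, add_zero]
  have h3 : (((x, t) : (ι → ℝ) × ℝ) + ((y, 0) : (ι → ℝ) × ℝ)) = (x + y, t) := by simp
  rw [← h3]
  exact h

theorem gDist_vertical_le (hb : IsJordanBasis A b) (x : ι → ℝ) (t u : ℝ) :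
    gDist (leftInvariantMetric A b) ((x, t) : (ι → ℝ) × ℝ) ((x, t + u) : (ι → ℝ) × ℝ) ≤
      ENNReal.ofReal |u| := by
  have h := gDist_add_le (leftInvariantMetric A b) ((x, t) : (ι → ℝ) × ℝ) ((0, u) : (ι → ℝ) × ℝ)
    (C := |u|) fun s _ => by
      refine (gNorm_le hb _ _).trans_eq ?_
      change (∑ i, _ * |b.repr (0 : ι → ℝ) i|) + |u| = _
      simp
  have h3 : (((x, t) : (ι → ℝ) × ℝ) + ((0, u) : (ι → ℝ) × ℝ)) = (x, t + u) := by simp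
  rw [← h3]
  exact h

theorem gDist_ne_top (hb : IsJordanBasis A b) (p q : AbelianExt A) :
    gDist (leftInvariantMetric A b) p q ≠ ⊤ := by
  obtain ⟨x, t⟩ := p
  obtain ⟨y, u⟩ := q
  have h1 := gDist_horizontal_le hb x (y - x) t
  have h2 := gDist_vertical_le hb y t (u - t)
  rw [add_sub_cancel] at h1 h2
  exact ne_top_of_le_ne_top
    (ENNReal.add_ne_top.2 ⟨ne_top_of_le_ne_top ENNReal.ofReal_ne_top h1,
      ne_top_of_le_ne_top ENNReal.ofReal_ne_top h2⟩) (gDist_triangle _ _ _ _)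

/-- The point `(x, t)` is reached from the origin by moving horizontally at height `0`, then
vertically to height `t`, then horizontally at height `t`: each horizontal coordinate is moved at
whichever of the two heights is the cheaper one. -/
theorem gDist_zero_le (hb : IsJordanBasis A b) (q : AbelianExt A)
    (hq : ∀ i, |b.repr q.1 i| ≤ max 1 (Real.exp (q.2 * diagWeight A b i))) :
    gDist (leftInvariantMetric A b) 0 q ≤
      ENNReal.ofReal (2 * Fintype.card ι + |q.2|) := by
  obtain ⟨x, t⟩ := q
  change ∀ i, |b.repr x i| ≤ max 1 (Real.exp (t * diagWeight A b i)) at hq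
  set u : ι → ℝ := b.equivFun.symm fun i => if |b.repr x i| ≤ 1 then b.repr x i else 0 with hu
  have hur : ∀ i, b.repr u i = if |b.repr x i| ≤ 1 then b.repr x i else 0 := fun i => by
    rw [← Module.Basis.equivFun_apply, hu, LinearEquiv.apply_symm_apply]
  have h1 := gDist_horizontal_le hb 0 u 0
  have h2 := gDist_vertical_le hb u 0 t
  have h3 := gDist_horizontal_le hb u (x - u) t
  rw [zero_add] at h1 h2
  rw [add_sub_cancel] at h3
  have hc1 : ∑ i, Real.exp (-(0 * diagWeight A b i)) * |b.repr u i| ≤ Fintype.card ι := by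
    refine (Finset.sum_le_card_nsmul _ _ 1 fun i _ => ?_).trans_eq (by simp)
    rw [hur]
    split_ifs with h
    · simpa using h
    · simp
  have hc3 : ∑ i, Real.exp (-(t * diagWeight A b i)) * |b.repr (x - u) i| ≤ Fintype.card ι := by
    refine (Finset.sum_le_card_nsmul _ _ 1 fun i _ => ?_).trans_eq (by simp)
    rw [map_sub, Finsupp.sub_apply, hur]
    split_ifs with h
    · simp
    · rw [Real.exp_neg, inv_mul_le_iff₀ (Real.exp_pos _), sub_zero, mul_one]
      exact (le_max_iff.1 (hq i)).resolve_left h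
  refine (gDist_triangle _ _ ((u, t) : (ι → ℝ) × ℝ) _).trans ?_
  refine (add_le_add_left (gDist_triangle _ _ ((u, 0) : (ι → ℝ) × ℝ) _) _).trans ?_
  refine (add_le_add (add_le_add (h1.trans (ENNReal.ofReal_le_ofReal hc1)) h2)
    (h3.trans (ENNReal.ofReal_le_ofReal hc3))).trans_eq ?_
  rw [← ENNReal.ofReal_add (by positivity) (by positivity),
    ← ENNReal.ofReal_add (by positivity) (by positivity)]
  congr 1
  change _ = 2 * (Fintype.card ι : ℝ) + |t|
  ring

/-- The Riemannian volume of a family of boxes, by Fubini: the determinant of the basis cancels. -/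
theorem gVol_boxes (hb : IsJordanBasis A b) {s : Set ℝ} (hs : MeasurableSet s) {ρ : ι → ℝ → ℝ}
    (hρ : ∀ i, Continuous (ρ i)) (hρ0 : ∀ i t, 0 ≤ ρ i t) :
    gVol (leftInvariantMetric A b) {q | q.2 ∈ s ∧ ∀ i, |b.repr q.1 i| ≤ ρ i q.2} =
      ∫⁻ t in s, ENNReal.ofReal
        (Real.exp (-(t * ∑ i, diagWeight A b i)) * ∏ i, (2 * ρ i t)) := by
  set P : (ι → ℝ) →ₗ[ℝ] (ι → ℝ) := (b.equivFun : (ι → ℝ) →ₗ[ℝ] (ι → ℝ)) with hP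
  have hPd : (LinearMap.toMatrix' P).det = LinearMap.det P := LinearMap.det_toMatrix' P
  have hdet : LinearMap.det P ≠ 0 := (LinearEquiv.isUnit_det' b.equivFun).ne_zero
  set S : Set ((ι → ℝ) × ℝ) := {q | q.2 ∈ s ∧ ∀ i, |b.repr q.1 i| ≤ ρ i q.2} with hS
  have hPm : Measurable P := (LinearMap.continuous_of_finiteDimensional P).measurable
  have hSm : MeasurableSet S := by
    have h1 : S = (Prod.snd ⁻¹' s) ∩ ⋂ i, {q : (ι → ℝ) × ℝ | |P q.1 i| ≤ ρ i q.2} := by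
      ext q; simp [hS, hP]
    rw [h1]
    refine (measurable_snd hs).inter (MeasurableSet.iInter fun i => measurableSet_le ?_ ?_)
    · exact ((measurable_pi_apply i).comp (hPm.comp measurable_fst)).abs
    · exact (hρ i).measurable.comp measurable_snd
  have hfib : ∀ t ∈ s, volume {x : ι → ℝ | (x, t) ∈ S} =
      ENNReal.ofReal (|LinearMap.det P|⁻¹ * ∏ i, (2 * ρ i t)) := by
    intro t ht
    have h1 : {x : ι → ℝ | (x, t) ∈ S} =
        P ⁻¹' (Set.pi Set.univ fun i => Set.Icc (-ρ i t) (ρ i t)) := by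
      ext x; simp only [Set.mem_ofPred_eq, Set.mem_preimage, Set.mem_univ_pi, Set.mem_Icc, ← abs_le, hS, ht, true_and, hP]; rfl
    rw [h1, ← Measure.map_apply hPm (MeasurableSet.univ_pi fun i => measurableSet_Icc),
      Real.map_linearMap_volume_pi_eq_smul_volume_pi hdet, Measure.smul_apply, smul_eq_mul,
      volume_pi_pi, abs_inv, ENNReal.ofReal_mul (by positivity), ENNReal.ofReal_prod_of_nonneg
        (fun i _ => mul_nonneg two_pos.le (hρ0 i t))]
    simp only [Real.volume_Icc, sub_neg_eq_add, two_mul]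
  have h0 : gVol (leftInvariantMetric A b) S = ∫⁻ q : (ι → ℝ) × ℝ in S,
      ENNReal.ofReal (|LinearMap.det P| * Real.exp (-(q.2 * ∑ i, diagWeight A b i))) := by
    refine (withDensity_apply _ hSm).trans ?_
    refine lintegral_congr fun q => ?_
    exact congrArg ENNReal.ofReal (hPd ▸ gram_leftInvariantMetric_det hb q)
  refine h0.trans ?_
  rw [← lintegral_indicator hSm]
  have hmeas : Measurable fun q : (ι → ℝ) × ℝ =>
      ENNReal.ofReal (|LinearMap.det P| * Real.exp (-(q.2 * ∑ i, diagWeight A b i))) := by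
    fun_prop
  rw [Measure.volume_eq_prod, lintegral_prod_symm' _ (hmeas.indicator hSm),
    ← lintegral_indicator hs]
  refine lintegral_congr fun t => ?_
  by_cases ht : t ∈ s
  · have h1 : ∀ x : ι → ℝ, S.indicator (fun q : (ι → ℝ) × ℝ =>
        ENNReal.ofReal (|LinearMap.det P| * Real.exp (-(q.2 * ∑ i, diagWeight A b i)))) (x, t) =
        {x : ι → ℝ | (x, t) ∈ S}.indicator (fun _ =>
          ENNReal.ofReal (|LinearMap.det P| * Real.exp (-(t * ∑ i, diagWeight A b i)))) x :=
      fun x => rfl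
    simp only [h1]
    have hSt : MeasurableSet {x : ι → ℝ | (x, t) ∈ S} := measurable_prodMk_right hSm
    rw [lintegral_indicator_const hSt, hfib t ht,
      Set.indicator_of_mem ht, ← ENNReal.ofReal_mul (by positivity)]
    congr 1
    have : |LinearMap.det P| ≠ 0 := abs_ne_zero.2 hdet
    field_simp
  · rw [Set.indicator_of_notMem ht, ← lintegral_zero (μ := (volume : Measure (ι → ℝ)))]
    refine lintegral_congr fun x => Set.indicator_of_notMem (fun h => ht h.1) _

end AbelianExt

/-! ### The entropy in terms of the weights -/

namespace AbelianExt

variable {ι : Type*} [Fintype ι] [DecidableEq ι] {A : Matrix ι ι ℝ}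
  {b : Module.Basis ι ℝ (ι → ℝ)}

/-- The exponential growth rate of the balls: the larger of `∑ max(l i, 0)` and `∑ max(-l i, 0)`,
where `l i` are the weights of `A` in the basis `b`. -/
noncomputable def growthRate (A : Matrix ι ι ℝ) (b : Module.Basis ι ℝ (ι → ℝ)) : ℝ :=
  ((∑ i, |diagWeight A b i|) + |∑ i, diagWeight A b i|) / 2

/-- Every point of the ball has coordinates bounded as in `bounds_of_gDist_lt`.  At height `t` the
fibre of these bounds has volume at most
`(2 r) ^ k * exp ((r * ∑ |l i| - t * ∑ l i) / 2)`, which on `[-r, r]` is largest at an endpoint. -/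
theorem gVol_gBall_zero_le (hb : IsJordanBasis A b) {r : ℝ} (hr : 0 ≤ r) :
    gVol (leftInvariantMetric A b) (gBall (leftInvariantMetric A b) 0 r) ≤
      ENNReal.ofReal ((2 * r) ^ (Fintype.card ι + 1) * Real.exp (growthRate A b * r)) := by
  set l := diagWeight A b with hl
  let ρ : ι → ℝ → ℝ := fun i t => r * Real.exp ((l i * t + |l i| * r) / 2)
  have hsub : gBall (leftInvariantMetric A b) 0 r ⊆
      {q | q.2 ∈ Set.Icc (-r) r ∧ ∀ i, |b.repr q.1 i| ≤ ρ i q.2} := by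
    intro q hq
    obtain ⟨h1, h2⟩ := bounds_of_gDist_lt hb hq
    change |q.2 - 0| ≤ r at h1
    change ∀ i, |b.repr q.1 i - b.repr (0 : ι → ℝ) i| ≤
      r * Real.exp ((l i * (0 + q.2) + |l i| * r) / 2) at h2
    rw [sub_zero] at h1
    simp only [map_zero, Finsupp.coe_zero, Pi.zero_apply, sub_zero, zero_add] at h2
    exact ⟨abs_le.1 h1, h2⟩
  refine (measure_mono hsub).trans ?_
  rw [gVol_boxes hb measurableSet_Icc (fun i => by fun_prop) (fun i t => by positivity)]
  calc _ ≤ ∫⁻ _ in Set.Icc (-r) r, ENNReal.ofReal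
        ((2 * r) ^ Fintype.card ι * Real.exp (growthRate A b * r)) := by
        refine setLIntegral_mono' measurableSet_Icc fun t ht => ENNReal.ofReal_le_ofReal ?_
        have h1 : ∏ i, (2 * ρ i t) = (2 * r) ^ Fintype.card ι *
            Real.exp (∑ i, (l i * t + |l i| * r) / 2) := by
          rw [Real.exp_sum, ← Finset.card_univ, ← Finset.prod_const, ← Finset.prod_mul_distrib]
          exact Finset.prod_congr rfl fun i _ => by simp only [ρ]; ring
        rw [h1, mul_left_comm, ← Real.exp_add]
        refine mul_le_mul_of_nonneg_left (Real.exp_le_exp.2 ?_) (by positivity)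
        rw [← Finset.sum_div, Finset.sum_add_distrib, ← Finset.sum_mul, ← Finset.sum_mul]
        have h2 : -((∑ i, l i) * t) ≤ |∑ i, l i| * r := by
          refine (neg_le_abs _).trans ?_
          rw [abs_mul]
          exact mul_le_mul_of_nonneg_left (abs_le.2 ht) (abs_nonneg _)
        rw [growthRate, ← hl]
        linarith
    _ = _ := by
        rw [setLIntegral_const, Real.volume_Icc, ← ENNReal.ofReal_mul (by positivity)]
        congr 1
        ring

/-- The ball contains, at each height `|t| ≤ R`, the box of half-sides `max 1 (exp (t * l i))`, whose
Riemannian volume is at least `exp ((|t| * ∑ |l i| - t * ∑ l i) / 2)`.  For `|t|` close to `R` and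
`t` of the sign opposite to that of `∑ l i` this is about `exp (R * growthRate A b)`. -/
theorem le_gVol_gBall_zero (hb : IsJordanBasis A b) {R : ℝ} (hR : 1 ≤ R) :
    ENNReal.ofReal (Real.exp (growthRate A b * (R - 1))) ≤
      gVol (leftInvariantMetric A b)
        (gBall (leftInvariantMetric A b) 0 (2 * Fintype.card ι + 1 + R)) := by
  set l := diagWeight A b with hl
  let ρ : ι → ℝ → ℝ := fun i t => max 1 (Real.exp (t * l i))
  -- Heights of largest fibres: negative if the trace is nonnegative, and positive otherwise.
  obtain ⟨s, hs, hs1, hsR⟩ : ∃ s : Set ℝ, MeasurableSet s ∧ volume s = 1 ∧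
      ∀ t ∈ s, |t| ≤ R ∧ R - 1 ≤ |t| ∧ -(t * ∑ i, l i) = |t| * |∑ i, l i| := by
    rcases le_total 0 (∑ i, l i) with h | h
    · refine ⟨Set.Icc (-R) (-(R - 1)), measurableSet_Icc, by simp, fun t ht => ?_⟩
      have h1 : t ≤ 0 := by linarith [ht.2]
      rw [abs_of_nonneg h, abs_of_nonpos h1]
      exact ⟨by linarith [ht.1], by linarith [ht.2], by ring⟩
    · refine ⟨Set.Icc (R - 1) R, measurableSet_Icc, by simp, fun t ht => ?_⟩
      have h1 : 0 ≤ t := by linarith [ht.1]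
      rw [abs_of_nonpos h, abs_of_nonneg h1]
      exact ⟨ht.2, ht.1, by ring⟩
  have hsub : {q : AbelianExt A | q.2 ∈ s ∧ ∀ i, |b.repr q.1 i| ≤ ρ i q.2} ⊆
      gBall (leftInvariantMetric A b) 0 (2 * Fintype.card ι + 1 + R) := by
    intro q hq
    refine (gDist_zero_le hb q hq.2).trans_lt ((ENNReal.ofReal_lt_ofReal_iff (by positivity)).2 ?_)
    linarith [(hsR _ hq.1).1]
  refine le_trans ?_ (measure_mono hsub)
  rw [gVol_boxes hb hs (fun i => by fun_prop) (fun i t => by positivity)]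
  calc _ = ∫⁻ _ in s, ENNReal.ofReal (Real.exp (growthRate A b * (R - 1))) := by
        rw [setLIntegral_const, hs1, mul_one]
    _ ≤ _ := by
        refine setLIntegral_mono' hs fun t ht => ENNReal.ofReal_le_ofReal ?_
        obtain ⟨-, h1, h2⟩ := hsR t ht
        have h3 : Real.exp (∑ i, (t * l i + |t| * |l i|) / 2) ≤ ∏ i, (2 * ρ i t) := by
          rw [Real.exp_sum]
          refine Finset.prod_le_prod (fun i _ => (Real.exp_pos _).le) fun i _ => ?_
          have h4 : Real.exp ((t * l i + |t| * |l i|) / 2) ≤ ρ i t := by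
            rw [← abs_mul]
            rcases le_total 0 (t * l i) with h | h
            · rw [abs_of_nonneg h]
              exact le_max_of_le_right (Real.exp_le_exp.2 (by linarith))
            · rw [abs_of_nonpos h]
              exact le_max_of_le_left (by simp)
          linarith [(Real.exp_pos ((t * l i + |t| * |l i|) / 2))]
        refine le_trans ?_ (mul_le_mul_of_nonneg_left h3 (Real.exp_pos _).le)
        rw [← Real.exp_add, h2]
        refine Real.exp_le_exp.2 ?_
        rw [← Finset.sum_div, Finset.sum_add_distrib, ← Finset.mul_sum, ← Finset.mul_sum]
        have h5 : 0 ≤ growthRate A b := by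
          rw [growthRate]
          have := Finset.sum_nonneg fun i (_ : i ∈ Finset.univ) => abs_nonneg (diagWeight A b i)
          positivity
        have h6 : growthRate A b * (R - 1) ≤ growthRate A b * |t| :=
          mul_le_mul_of_nonneg_left h1 h5
        refine h6.trans_eq ?_
        rw [growthRate, ← hl]
        linear_combination (1 / 2 : ℝ) * h2

theorem gBall_subset_gBall {g : Bundle.RiemannianMetric
      (fun p : AbelianExt A => TangentSpace 𝓘(ℝ, AbelianExt A) p)} {p q : AbelianExt A} {D : ℝ}
    (hD : 0 ≤ D) (h : gDist g p q ≤ ENNReal.ofReal D) (r : ℝ) :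
    gBall g q r ⊆ gBall g p (r + D) := by
  intro x hx
  have hr : 0 < r := ENNReal.ofReal_pos.1 (bot_le.trans_lt hx)
  refine (gDist_triangle g p q x).trans_lt ?_
  rw [add_comm r, ENNReal.ofReal_add hD hr.le]
  exact ENNReal.add_lt_add_of_le_of_lt (ne_top_of_le_ne_top ENNReal.ofReal_ne_top h) h hx

theorem tendsto_log_div_of_exp_bounds {f : ℝ → ℝ} {h D E : ℝ} {k : ℕ}
    (hlow : ∀ᶠ r in atTop, Real.exp (h * (r - D)) ≤ f r)
    (hup : ∀ᶠ r in atTop, f r ≤ (2 * (r + E)) ^ k * Real.exp (h * (r + E))) :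
    Tendsto (fun r => Real.log (f r) / r) atTop (𝓝 h) := by
  have hinv : Tendsto (fun r : ℝ => r⁻¹) atTop (𝓝 0) := tendsto_inv_atTop_zero
  have hlog : Tendsto (fun r : ℝ => Real.log (2 * (r + E)) / r) atTop (𝓝 0) := by
    have h1 : Tendsto (fun x : ℝ => Real.log x / (2⁻¹ * x + -E)) atTop (𝓝 0) := by
      simpa using Real.tendsto_pow_log_div_mul_add_atTop 2⁻¹ (-E) 1 (by norm_num)
    have h2 : Tendsto (fun r : ℝ => 2 * (r + E)) atTop atTop :=
      (tendsto_atTop_add_const_right _ _ tendsto_id).const_mul_atTop two_pos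
    refine (h1.comp h2).congr fun r => ?_
    simp only [Function.comp_apply]
    congr 1
    ring
  have hl : Tendsto (fun r : ℝ => h - h * D * r⁻¹) atTop (𝓝 h) := by
    simpa using tendsto_const_nhds.sub (hinv.const_mul (h * D))
  have hu : Tendsto (fun r : ℝ => k * (Real.log (2 * (r + E)) / r) + (h + h * E * r⁻¹))
      atTop (𝓝 h) := by
    simpa using (hlog.const_mul (k : ℝ)).add (tendsto_const_nhds.add (hinv.const_mul (h * E)))
  refine tendsto_of_tendsto_of_tendsto_of_le_of_le' hl hu ?_ ?_
  · filter_upwards [hlow, eventually_gt_atTop 0] with r h1 hr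
    have h2 : h * (r - D) ≤ Real.log (f r) := by
      rw [← Real.log_exp (h * (r - D))]
      exact Real.log_le_log (Real.exp_pos _) h1
    rw [le_div_iff₀ hr]
    refine le_trans (le_of_eq ?_) h2
    field_simp
  · filter_upwards [hlow, hup, eventually_gt_atTop 0, eventually_gt_atTop (-E)] with r h1 h1' hr hE
    have h2 : Real.log (f r) ≤ k * Real.log (2 * (r + E)) + h * (r + E) := by
      have hE' : 0 < 2 * (r + E) := by linarith
      refine (Real.log_le_log ((Real.exp_pos _).trans_le h1) h1').trans_eq ?_
      rw [Real.log_mul (pow_pos hE' k).ne' (Real.exp_pos _).ne', Real.log_pow, Real.log_exp]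
    rw [div_le_iff₀ hr]
    refine h2.trans (le_of_eq ?_)
    field_simp

/-- Changing the base point changes radii by a bounded amount, so the bounds for balls centred at the
origin give the entropy at every point. -/
theorem hasVolumeEntropy_growthRate (hb : IsJordanBasis A b) :
    HasVolumeEntropy (leftInvariantMetric A b) (growthRate A b) := by
  set g := leftInvariantMetric A b with hg
  intro p
  obtain ⟨D, hD0, hD⟩ : ∃ D : ℝ, 0 ≤ D ∧ gDist g 0 p ≤ ENNReal.ofReal D :=
    ⟨_, ENNReal.toReal_nonneg, (ENNReal.ofReal_toReal (gDist_ne_top hb 0 p)).ge⟩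
  obtain ⟨E, hE0, hE⟩ : ∃ E : ℝ, 0 ≤ E ∧ gDist g p 0 ≤ ENNReal.ofReal E :=
    ⟨_, ENNReal.toReal_nonneg, (ENNReal.ofReal_toReal (gDist_ne_top hb p 0)).ge⟩
  have hup : ∀ r, 0 ≤ r → gVol g (gBall g p r) ≤ ENNReal.ofReal
      ((2 * (r + D)) ^ (Fintype.card ι + 1) * Real.exp (growthRate A b * (r + D))) := fun r hr =>
    (measure_mono (gBall_subset_gBall hD0 hD r)).trans (gVol_gBall_zero_le hb (by positivity))
  have hfin : ∀ r, gVol g (gBall g p r) ≠ ⊤ := by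
    intro r
    refine ne_top_of_le_ne_top ENNReal.ofReal_ne_top
      ((measure_mono fun q hq => ?_).trans (hup (max r 0) (le_max_right _ _)))
    exact lt_of_lt_of_le hq (ENNReal.ofReal_le_ofReal (le_max_left _ _))
  refine ⟨hfin, tendsto_log_div_of_exp_bounds (D := 2 * Fintype.card ι + 2 + E) (E := D)
    (k := Fintype.card ι + 1) ?_ ?_⟩
  · filter_upwards [eventually_ge_atTop (2 * Fintype.card ι + 2 + E)] with r hr
    rw [← ENNReal.ofReal_le_iff_le_toReal (hfin r)]
    have h1 := le_gVol_gBall_zero hb (R := r - (2 * Fintype.card ι + 1 + E)) (by linarith)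
    have h2 := gBall_subset_gBall hE0 hE (r - E)
    rw [sub_add_cancel] at h2
    refine le_trans (le_of_eq ?_) (h1.trans (measure_mono (le_trans (le_of_eq ?_) h2)))
    · congr 3; ring
    · congr 1; ring
  · filter_upwards [eventually_ge_atTop 0] with r hr
    exact ENNReal.toReal_le_of_le_ofReal (by positivity) (hup r hr)

end AbelianExt

/-! ### Characteristic polynomial and existence of real Jordan forms -/

theorem Matrix.charpoly_blockDiagonal {R n o : Type*} [CommRing R] [Fintype n] [DecidableEq n]
    [Fintype o] [DecidableEq o] (M : o → Matrix n n R) :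
    (Matrix.blockDiagonal M).charpoly = ∏ j, (M j).charpoly := by
  have h : (Matrix.blockDiagonal M).charmatrix = Matrix.blockDiagonal fun j => (M j).charmatrix := by
    ext ⟨i, j⟩ ⟨i', j'⟩ : 2
    simp only [Matrix.charmatrix_apply, Matrix.blockDiagonal_apply, Matrix.diagonal_apply,
      Prod.mk.injEq]
    by_cases hj : j = j' <;> simp [hj]
  rw [Matrix.charpoly, h, Matrix.det_blockDiagonal]
  rfl

open Polynomial in
/-- The diagonal of a real Jordan form lists the real parts of its complex eigenvalues, with
multiplicity. -/
theorem IsRealJordanForm.exists_charpoly_eq_prod {ι : Type*} [Fintype ι] [DecidableEq ι]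
    {J : Matrix ι ι ℝ} (hJ : IsRealJordanForm J) :
    ∃ z : ι → ℂ, (∀ i, (z i).re = J i i) ∧
      (J.map Complex.ofReal).charpoly = ∏ i, (X - C (z i)) := by
  obtain ⟨k, l, e, a, α, β, h⟩ := hJ
  let z : Fin k ⊕ Fin 2 × Fin l → ℂ := Sum.elim (fun i => (a i : ℂ))
    fun p => if p.1 = 0 then α p.2 + β p.2 * Complex.I else α p.2 - β p.2 * Complex.I
  refine ⟨z ∘ e.symm, fun i => ?_, ?_⟩
  · have h0 : J i i = J.submatrix e e (e.symm i) (e.symm i) := by simp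
    rw [h0, h, Function.comp_apply]
    rcases e.symm i with i | ⟨i, j⟩
    · simp [z]
    · fin_cases i <;> simp [z, Matrix.blockDiagonal_apply]
  · have h1 : (J.map Complex.ofReal).charpoly =
        ((J.map Complex.ofReal).submatrix e e).charpoly :=
      (Matrix.charpoly_reindex e.symm (J.map Complex.ofReal)).symm
    have h2 : ∀ x y : ℝ, (!![x, -y; y, x].map Complex.ofReal).charpoly =
        (X - C (x + y * Complex.I)) * (X - C (x - y * Complex.I)) := by
      intro x y
      have h3 : C (y * Complex.I : ℂ) * C (y * Complex.I : ℂ) = -(C (y : ℂ) * C (y : ℂ)) := by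
        rw [← C_mul, ← C_mul, ← C_neg]
        congr 1
        linear_combination (y : ℂ) ^ 2 * Complex.I_mul_I
      rw [Matrix.charpoly_fin_two, Matrix.trace_fin_two, Matrix.det_fin_two]
      simp only [Matrix.map_apply, Matrix.of_apply, Matrix.cons_val', Matrix.cons_val_zero,
        Matrix.cons_val_one, Matrix.cons_val_fin_one, Complex.ofReal_neg, C_add, C_sub, C_mul, C_neg]
      simp only [C_mul] at h3
      linear_combination h3
    rw [h1, Matrix.submatrix_map, h, Matrix.fromBlocks_map, Matrix.map_zero _ Complex.ofReal_zero,
      Matrix.map_zero _ Complex.ofReal_zero, Matrix.charpoly_fromBlocks_zero₁₂,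
      Matrix.diagonal_map Complex.ofReal_zero, Matrix.blockDiagonal_map _ _ Complex.ofReal_zero,
      Matrix.charpoly_diagonal, Matrix.charpoly_blockDiagonal, ← Equiv.prod_comp e]
    simp only [h2, Function.comp_apply, Equiv.symm_apply_apply, Fintype.prod_sum_type,
      Fintype.prod_prod_type, Fin.prod_univ_two, Finset.prod_mul_distrib]
    simp [z]

section JordanSystem

variable {V : Type*} [AddCommGroup V] [Module ℝ V]

/-- The subspace `W` has a basis in which `T` is in real Jordan form; the basis vectors are indexed
by a type `K` of blocks of size one and a type `L` of blocks of size two. -/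
def HasJordanSystem (T : V →ₗ[ℝ] V) (W : Submodule ℝ V) : Prop :=
  ∃ (K L : Type) (_ : Fintype K) (_ : Fintype L) (v : K ⊕ Fin 2 × L → V)
    (a : K → ℝ) (α β : L → ℝ), LinearIndependent ℝ v ∧ Submodule.span ℝ (Set.range v) = W ∧
    (∀ k, T (v (.inl k)) = a k • v (.inl k)) ∧
    (∀ l, T (v (.inr (0, l))) = α l • v (.inr (0, l)) + β l • v (.inr (1, l))) ∧
    ∀ l, T (v (.inr (1, l))) = -β l • v (.inr (0, l)) + α l • v (.inr (1, l))

/-- A subspace with a Jordan system is `T`-invariant. -/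
theorem HasJordanSystem.map_mem {T : V →ₗ[ℝ] V} {W : Submodule ℝ V} (h : HasJordanSystem T W)
    {x : V} (hx : x ∈ W) : T x ∈ W := by
  obtain ⟨K, L, _, _, v, a, α, β, -, rfl, h1, h2, h3⟩ := h
  have hv : ∀ i : K ⊕ Fin 2 × L, v i ∈ Submodule.span ℝ (Set.range v) := fun i =>
    Submodule.subset_span ⟨i, rfl⟩
  suffices Submodule.span ℝ (Set.range v) ≤ (Submodule.span ℝ (Set.range v)).comap T from this hx
  rw [Submodule.span_le]
  rintro _ ⟨k | ⟨i, l⟩, rfl⟩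
  · rw [SetLike.mem_coe, Submodule.mem_comap, h1]
    exact Submodule.smul_mem _ _ (hv _)
  · rw [SetLike.mem_coe, Submodule.mem_comap]
    obtain rfl | rfl : i = 0 ∨ i = 1 := by fin_cases i <;> simp
    · rw [h2]
      exact Submodule.add_mem _ (Submodule.smul_mem _ _ (hv _)) (Submodule.smul_mem _ _ (hv _))
    · rw [h3]
      exact Submodule.add_mem _ (Submodule.smul_mem _ _ (hv _)) (Submodule.smul_mem _ _ (hv _))

theorem hasJordanSystem_bot (T : V →ₗ[ℝ] V) : HasJordanSystem T ⊥ :=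
  ⟨Empty, Empty, inferInstance, inferInstance, fun _ => 0, fun _ => 0, fun _ => 0, fun _ => 0,
    linearIndependent_empty_type, by simp, fun k => k.elim, fun k => k.elim, fun k => k.elim⟩

theorem HasJordanSystem.exists_mem_of_eigenvector {T : V →ₗ[ℝ] V} {W : Submodule ℝ V}
    (h : HasJordanSystem T W) {x : V} {c : ℝ} (hx : T x = c • x) :
    ∃ W', HasJordanSystem T W' ∧ W ≤ W' ∧ x ∈ W' := by
  by_cases hxW : x ∈ W
  · exact ⟨W, h, le_rfl, hxW⟩
  obtain ⟨K, L, _, _, v, a, α, β, hv, rfl, h1, h2, h3⟩ := h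
  let v' : Option K ⊕ Fin 2 × L → V := Sum.elim
    (fun k => k.elim x fun k => v (.inl k)) fun p => v (.inr p)
  refine ⟨_, ⟨Option K, L, inferInstance, inferInstance, v', fun k => k.elim c a, α, β, ?_, rfl,
    ?_, h2, h3⟩, ?_, Submodule.subset_span ⟨.inl none, rfl⟩⟩
  · rw [Fintype.linearIndependent_iff] at hv ⊢
    intro f hf
    let f' : K ⊕ Fin 2 × L → ℝ := Sum.elim (fun k => f (.inl (some k))) fun p => f (.inr p)
    have hf' : f (.inl none) • x + ∑ i, f' i • v i = 0 := by
      rw [← hf]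
      simp [f', v', Fintype.sum_sum_type, Fintype.sum_option, add_assoc]
    have h0 : f (.inl none) = 0 := by
      by_contra h0
      refine hxW ((Submodule.smul_mem_iff _ h0).1 ?_)
      rw [eq_neg_of_add_eq_zero_left hf']
      exact Submodule.neg_mem _ (Submodule.sum_mem _ fun i _ =>
        Submodule.smul_mem _ _ (Submodule.subset_span ⟨i, rfl⟩))
    rw [h0, zero_smul, zero_add] at hf'
    rintro ((_ | k) | p)
    · exact h0
    · exact hv f' hf' (.inl k)
    · exact hv f' hf' (.inr p)
  · rintro (_ | k)
    · exact hx
    · exact h1 k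
  · refine Submodule.span_mono ?_
    rintro _ ⟨k | p, rfl⟩
    · exact ⟨.inl (some k), rfl⟩
    · exact ⟨.inr p, rfl⟩

theorem HasJordanSystem.exists_mem_of_plane {T : V →ₗ[ℝ] V} {W : Submodule ℝ V}
    (h : HasJordanSystem T W) {x y : V} {c d : ℝ} (hx : T x = c • x + d • y)
    (hy : T y = -d • x + c • y) :
    ∃ W', HasJordanSystem T W' ∧ W ≤ W' ∧ x ∈ W' ∧ y ∈ W' := by
  rcases eq_or_ne d 0 with rfl | hd
  · obtain ⟨W₁, hW₁, hle₁, hx₁⟩ := h.exists_mem_of_eigenvector (x := x) (c := c) (by simpa using hx)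
    obtain ⟨W₂, hW₂, hle₂, hy₂⟩ := hW₁.exists_mem_of_eigenvector (x := y) (c := c)
      (by simpa using hy)
    exact ⟨W₂, hW₂, hle₁.trans hle₂, hle₂ hx₁, hy₂⟩
  have hinv : ∀ z ∈ W, T z ∈ W := fun z hz => h.map_mem hz
  by_cases hxW : x ∈ W
  · refine ⟨W, h, le_rfl, hxW, (Submodule.smul_mem_iff W hd).1 ?_⟩
    have h1 : d • y = T x - c • x := by rw [hx]; abel
    rw [h1]
    exact W.sub_mem (hinv x hxW) (W.smul_mem c hxW)
  -- The plane spanned by `x` and `y` has no invariant line, so it meets `W` trivially.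
  have hdisj : ∀ s t : ℝ, s • x + t • y ∈ W → s = 0 ∧ t = 0 := by
    intro s t hst
    have h1 : d • (s • y - t • x) ∈ W := by
      have h2 : d • (s • y - t • x) = T (s • x + t • y) - c • (s • x + t • y) := by
        rw [map_add, map_smul, map_smul, hx, hy]
        module
      rw [h2]
      exact W.sub_mem (hinv _ hst) (W.smul_mem c hst)
    rw [Submodule.smul_mem_iff W hd] at h1
    have h2 : (s * s + t * t) • x ∈ W := by
      have h3 : (s * s + t * t) • x = s • (s • x + t • y) - t • (s • y - t • x) := by module
      rw [h3]
      exact W.sub_mem (W.smul_mem s hst) (W.smul_mem t h1)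
    have h3 : s * s + t * t = 0 := by
      by_contra h0
      exact hxW ((Submodule.smul_mem_iff W h0).1 h2)
    exact mul_self_add_mul_self_eq_zero.1 h3
  obtain ⟨K, L, _, _, v, a, α, β, hv, rfl, h1, h2, h3⟩ := h
  let v' : K ⊕ Fin 2 × Option L → V := Sum.elim (fun k => v (.inl k))
    fun p => p.2.elim (if p.1 = 0 then x else y) fun l => v (.inr (p.1, l))
  refine ⟨_, ⟨K, Option L, inferInstance, inferInstance, v', a, fun l => l.elim c α,
    fun l => l.elim d β, ?_, rfl, h1, ?_, ?_⟩, ?_, Submodule.subset_span ⟨.inr (0, none), rfl⟩,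
    Submodule.subset_span ⟨.inr (1, none), rfl⟩⟩
  · rw [Fintype.linearIndependent_iff] at hv ⊢
    intro f hf
    let f' : K ⊕ Fin 2 × L → ℝ := Sum.elim (fun k => f (.inl k)) fun p => f (.inr (p.1, some p.2))
    have hf' : (f (.inr (0, none)) • x + f (.inr (1, none)) • y) + ∑ i, f' i • v i = 0 := by
      rw [← hf]
      simp only [f', v', Fintype.sum_sum_type, Fintype.sum_option, Fintype.sum_prod_type,
        Fin.sum_univ_two, Sum.elim_inl, Sum.elim_inr, Option.elim, if_true, one_ne_zero, if_false]
      abel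
    have h0 := hdisj (f (.inr (0, none))) (f (.inr (1, none))) (by
      rw [eq_neg_of_add_eq_zero_left hf']
      exact Submodule.neg_mem _ (Submodule.sum_mem _ fun i _ =>
        Submodule.smul_mem _ _ (Submodule.subset_span ⟨i, rfl⟩)))
    rw [h0.1, h0.2, zero_smul, zero_smul, zero_add, zero_add] at hf'
    rintro (k | ⟨i, _ | l⟩)
    · exact hv f' hf' (.inl k)
    · fin_cases i
      · exact h0.1
      · exact h0.2
    · exact hv f' hf' (.inr (i, l))
  · rintro (_ | l)
    · exact hx
    · exact h2 l
  · rintro (_ | l)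
    · exact hy
    · exact h3 l
  · refine Submodule.span_mono ?_
    rintro _ ⟨k | ⟨i, l⟩, rfl⟩
    · exact ⟨.inl k, rfl⟩
    · exact ⟨.inr (i, some l), rfl⟩

end JordanSystem

theorem exists_isJordanBasis_of_hasJordanSystem_top {ι : Type*} [Fintype ι] [DecidableEq ι]
    {A : Matrix ι ι ℝ} (h : HasJordanSystem (Matrix.toLin' A) ⊤) : ∃ b, IsJordanBasis A b := by
  classical
  obtain ⟨K, L, _, _, v, a, α, β, hv, hs, h1, h2, h3⟩ := h
  let B : Module.Basis (K ⊕ Fin 2 × L) ℝ (ι → ℝ) := .mk hv hs.ge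
  have hB : ∀ i, B i = v i := fun i => Module.Basis.mk_apply hv hs.ge i
  let e : K ⊕ Fin 2 × L ≃ ι := B.indexEquiv (Pi.basisFun ℝ ι)
  let eK := Fintype.equivFin K
  let eL := Fintype.equivFin L
  let e' : Fin (Fintype.card K) ⊕ Fin 2 × Fin (Fintype.card L) ≃ K ⊕ Fin 2 × L :=
    Equiv.sumCongr eK.symm (Equiv.prodCongr (Equiv.refl _) eL.symm)
  refine ⟨B.reindex e, _, _, e'.trans e, a ∘ eK.symm, α ∘ eL.symm, β ∘ eL.symm, ?_⟩
  have hr : ∀ i j, B.repr (v j) i = if j = i then 1 else 0 := fun i j => by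
    rw [← hB, Module.Basis.repr_self, Finsupp.single_apply]
  ext i j
  rw [Matrix.submatrix_apply, LinearMap.toMatrix_apply]
  simp only [Module.Basis.reindex_apply, Module.Basis.repr_reindex_apply, Equiv.trans_apply,
    Equiv.symm_apply_apply, hB]
  rcases j with j | ⟨j', j⟩
  · change B.repr (Matrix.toLin' A (v (.inl (eK.symm j)))) _ = _
    rw [h1, map_smul, Finsupp.smul_apply, hr]
    rcases i with i | ⟨i', i⟩
    · change _ • (if Sum.inl (eK.symm j) = (Sum.inl (eK.symm i) : K ⊕ Fin 2 × L) then _ else _) = _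
      by_cases hij : j = i
      · simp [hij]
      · simp [hij, Ne.symm hij]
    · simp [e']
  · fin_cases j'
    · change B.repr (Matrix.toLin' A (v (.inr (0, eL.symm j)))) _ = _
      rw [h2, map_add, map_smul, map_smul, Finsupp.add_apply, Finsupp.smul_apply,
        Finsupp.smul_apply, hr, hr]
      rcases i with i | ⟨i', i⟩
      · simp [e']
      · by_cases hij : j = i
        · fin_cases i' <;> simp [hij, e', Matrix.blockDiagonal_apply]
        · simp [hij, Ne.symm hij, e', Matrix.blockDiagonal_apply]
    · change B.repr (Matrix.toLin' A (v (.inr (1, eL.symm j)))) _ = _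
      rw [h3, map_add, map_smul, map_smul, Finsupp.add_apply, Finsupp.smul_apply,
        Finsupp.smul_apply, hr, hr]
      rcases i with i | ⟨i', i⟩
      · simp [e']
      · by_cases hij : j = i
        · fin_cases i' <;> simp [hij, e', Matrix.blockDiagonal_apply]
        · simp [hij, Ne.symm hij, e', Matrix.blockDiagonal_apply]

/-- The real and imaginary parts of the complex eigenvectors span `ℝ^ι`, and those of each
eigenvector span an invariant line or plane. -/
theorem IsDiagonalizableOverC.exists_isJordanBasis {ι : Type*} [Fintype ι] [DecidableEq ι]
    {A : Matrix ι ι ℝ} (hA : IsDiagonalizableOverC A) : ∃ b, IsJordanBasis A b := by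
  obtain ⟨S, d, hS⟩ := hA
  let x : ι → ι → ℝ := fun j i => ((S : Matrix ι ι ℂ) i j).re
  let y : ι → ι → ℝ := fun j i => ((S : Matrix ι ι ℂ) i j).im
  have hAS : A.map Complex.ofReal * (S : Matrix ι ι ℂ) = (S : Matrix ι ι ℂ) * Matrix.diagonal d := by
    rw [hS, Units.inv_mul_cancel_right]
  have heig : ∀ i j, ∑ k, (A i k : ℂ) * (S : Matrix ι ι ℂ) k j = (S : Matrix ι ι ℂ) i j * d j := by
    intro i j
    have := congrFun (congrFun hAS i) j
    rwa [Matrix.mul_apply, Matrix.mul_diagonal] at this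
  have hx : ∀ j, Matrix.toLin' A (x j) = (d j).re • x j + (-(d j).im) • y j := by
    intro j
    ext i
    have := congrArg Complex.re (heig i j)
    rw [Complex.re_sum] at this
    simp only [Complex.mul_re, Complex.ofReal_re, Complex.ofReal_im, zero_mul, sub_zero] at this
    simp only [Matrix.toLin'_apply, Matrix.mulVec, dotProduct, x, y, Pi.add_apply, Pi.smul_apply,
      smul_eq_mul, this]
    ring
  have hy : ∀ j, Matrix.toLin' A (y j) = -(-(d j).im) • x j + (d j).re • y j := by
    intro j
    ext i
    have := congrArg Complex.im (heig i j)
    rw [Complex.im_sum] at this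
    simp only [Complex.mul_im, Complex.ofReal_re, Complex.ofReal_im, zero_mul, add_zero] at this
    simp only [Matrix.toLin'_apply, Matrix.mulVec, dotProduct, x, y, Pi.add_apply, Pi.smul_apply,
      smul_eq_mul, this]
    ring
  have hind : ∀ s : Finset ι, ∃ W, HasJordanSystem (Matrix.toLin' A) W ∧
      ∀ j ∈ s, x j ∈ W ∧ y j ∈ W := by
    intro s
    induction s using Finset.induction_on with
    | empty => exact ⟨⊥, hasJordanSystem_bot _, by simp⟩
    | insert j s _ ih =>
      obtain ⟨W, hW, hWs⟩ := ih
      obtain ⟨W', hW', hle, hxj, hyj⟩ := hW.exists_mem_of_plane (hx j) (hy j)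
      refine ⟨W', hW', fun i hi => ?_⟩
      rcases Finset.mem_insert.1 hi with rfl | hi
      · exact ⟨hxj, hyj⟩
      · exact ⟨hle (hWs i hi).1, hle (hWs i hi).2⟩
  obtain ⟨W, hW, hmem⟩ := hind Finset.univ
  suffices W = ⊤ by
    rw [this] at hW
    exact exists_isJordanBasis_of_hasJordanSystem_top hW
  rw [eq_top_iff]
  intro u _
  let c : ι → ℂ := ((S⁻¹ : (Matrix ι ι ℂ)ˣ) : Matrix ι ι ℂ) *ᵥ fun i => (u i : ℂ)
  have hc : (S : Matrix ι ι ℂ) *ᵥ c = fun i => (u i : ℂ) := by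
    rw [Matrix.mulVec_mulVec, Units.mul_inv, Matrix.one_mulVec]
  have hu : u = ∑ j, ((c j).re • x j - (c j).im • y j) := by
    ext i
    have := congrArg Complex.re (congrFun hc i)
    simp only [Matrix.mulVec, dotProduct, Complex.re_sum, Complex.mul_re, Complex.ofReal_re] at this
    rw [Finset.sum_apply, ← this]
    refine Finset.sum_congr rfl fun j _ => ?_
    simp only [x, y, Pi.sub_apply, Pi.smul_apply, smul_eq_mul]
    ring
  rw [hu]
  exact W.sum_mem fun j _ => W.sub_mem (W.smul_mem _ (hmem j (Finset.mem_univ j)).1)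
    (W.smul_mem _ (hmem j (Finset.mem_univ j)).2)

/-! ### Traces, and the horospherical product -/

theorem sum_diagWeight {ι : Type*} [Fintype ι] [DecidableEq ι] (M : Matrix ι ι ℝ)
    (b : Module.Basis ι ℝ (ι → ℝ)) : ∑ i, diagWeight M b i = M.trace := by
  have h := LinearMap.trace_eq_matrix_trace ℝ b (Matrix.toLin' M)
  rw [Matrix.trace_toLin'_eq] at h
  exact h.symm

/-- The weights are the real parts of the complex eigenvalues, with multiplicity, so this sum does
not depend on the Jordan basis. -/
theorem IsJordanBasis.sum_abs_diagWeight {ι : Type*} [Fintype ι] [DecidableEq ι]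
    {M : Matrix ι ι ℝ} {b : Module.Basis ι ℝ (ι → ℝ)} (hb : IsJordanBasis M b) :
    ∑ i, |diagWeight M b i| =
      ((M.map Complex.ofReal).charpoly.roots.map fun z => |z.re|).sum := by
  obtain ⟨z, hz, hp⟩ := IsRealJordanForm.exists_charpoly_eq_prod hb
  have h1 : (M.map Complex.ofReal).charpoly =
      ((LinearMap.toMatrix b b (Matrix.toLin' M)).map Complex.ofReal).charpoly := by
    have h2 : ∀ N : Matrix ι ι ℝ,
        (N.map Complex.ofReal).charpoly = N.charpoly.map Complex.ofRealHom := fun N =>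
      Matrix.charpoly_map N Complex.ofRealHom
    rw [h2, h2, LinearMap.charpoly_toMatrix, Matrix.charpoly_toLin']
  have h3 : ∏ i, (Polynomial.X - Polynomial.C (z i)) =
      ((Finset.univ.val.map z).map fun a => Polynomial.X - Polynomial.C a).prod := by
    rw [Multiset.map_map]
    rfl
  rw [h1, hp, h3, Polynomial.roots_multiset_prod_X_sub_C, Multiset.map_map]
  exact Finset.sum_congr rfl fun i _ => by rw [Function.comp_apply, hz]; rfl

theorem sum_re_roots_charpoly {ι : Type*} [Fintype ι] [DecidableEq ι] (M : Matrix ι ι ℝ) :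
    ((M.map Complex.ofReal).charpoly.roots.map Complex.re).sum = M.trace := by
  have h1 := Matrix.trace_eq_sum_roots_charpoly (M.map Complex.ofReal)
  have h2 : (M.map Complex.ofReal).trace = (M.trace : ℂ) := by
    simp [Matrix.trace]
  have h3 := congrArg Complex.reAddGroupHom (h2.symm.trans h1)
  rw [map_multiset_sum] at h3
  exact h3.symm

theorem IsHeintze.sum_abs_re_roots {ι : Type*} [Fintype ι] [DecidableEq ι] {M : Matrix ι ι ℝ}
    (hM : IsHeintze M) :
    ((M.map Complex.ofReal).charpoly.roots.map fun z => |z.re|).sum = M.trace := by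
  rw [← sum_re_roots_charpoly]
  refine congrArg Multiset.sum (Multiset.map_congr rfl fun z hz => abs_of_pos (hM z ?_))
  exact Matrix.mem_spectrum_iff_isRoot_charpoly.2 (Polynomial.isRoot_of_mem_roots hz)

theorem IsHeintze.sum_abs_re_roots_neg {ι : Type*} [Fintype ι] [DecidableEq ι] {M : Matrix ι ι ℝ}
    (hM : IsHeintze M) :
    (((-M).map Complex.ofReal).charpoly.roots.map fun z => |z.re|).sum = M.trace := by
  have h1 : (-M).map Complex.ofReal = -(M.map Complex.ofReal) := by
    ext i j; simp
  have h2 : (((-M).map Complex.ofReal).charpoly.roots.map fun z => |z.re|) =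
      ((-M).map Complex.ofReal).charpoly.roots.map fun z => -z.re := by
    refine Multiset.map_congr rfl fun z hz => abs_of_neg ?_
    have h3 : z ∈ spectrum ℂ ((-M).map Complex.ofReal) :=
      Matrix.mem_spectrum_iff_isRoot_charpoly.2 (Polynomial.isRoot_of_mem_roots hz)
    rw [h1, ← spectrum.neg_eq, Set.mem_neg] at h3
    simpa using hM _ h3
  rw [h2, Multiset.sum_map_neg, sum_re_roots_charpoly, Matrix.trace_neg, neg_neg]

theorem IsHeintze.growthRate_eq_trace {ι : Type*} [Fintype ι] [DecidableEq ι] {M : Matrix ι ι ℝ}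
    {b : Module.Basis ι ℝ (ι → ℝ)} (hM : IsHeintze M) (hb : IsJordanBasis M b) :
    AbelianExt.growthRate M b = M.trace := by
  have h1 := hb.sum_abs_diagWeight.trans hM.sum_abs_re_roots
  have h2 : 0 ≤ M.trace := h1 ▸ Finset.sum_nonneg fun i _ => abs_nonneg _
  rw [AbelianExt.growthRate, h1, sum_diagWeight, abs_of_nonneg h2, add_self_div_two]

section Horo

variable {m n : ℕ} {A : Matrix (Fin m) (Fin m) ℝ} {B : Matrix (Fin n) (Fin n) ℝ}

theorem growthRate_horoMatrix (hA : IsHeintze A) (hB : IsHeintze B)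
    {h : Module.Basis (Fin m ⊕ Fin n) ℝ (Fin m ⊕ Fin n → ℝ)}
    (hh : IsJordanBasis (horoMatrix A B) h) :
    AbelianExt.growthRate (horoMatrix A B) h = max A.trace B.trace := by
  have h1 : ∑ i, |diagWeight (horoMatrix A B) h i| = A.trace + B.trace := by
    rw [hh.sum_abs_diagWeight, horoMatrix, Matrix.fromBlocks_map,
      Matrix.map_zero _ Complex.ofReal_zero, Matrix.map_zero _ Complex.ofReal_zero,
      Matrix.charpoly_fromBlocks_zero₁₂, Polynomial.roots_mul
        (mul_ne_zero (Matrix.charpoly_monic _).ne_zero (Matrix.charpoly_monic _).ne_zero),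
      Multiset.map_add, Multiset.sum_add, hA.sum_abs_re_roots, hB.sum_abs_re_roots_neg]
  have h2 : (horoMatrix A B).trace = A.trace - B.trace := by
    simp [horoMatrix, Matrix.trace, sub_eq_add_neg]
  rw [AbelianExt.growthRate, h1, sum_diagWeight, h2]
  rcases le_total A.trace B.trace with h3 | h3
  · rw [max_eq_right h3, abs_of_nonpos (sub_nonpos.2 h3)]
    ring
  · rw [max_eq_left h3, abs_of_nonneg (sub_nonneg.2 h3)]
    ring

theorem IsDiagonalizableOverC.horoMatrix (hA : IsDiagonalizableOverC A)
    (hB : IsDiagonalizableOverC B) : IsDiagonalizableOverC (horoMatrix A B) := by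
  obtain ⟨S, d, hS⟩ := hA
  obtain ⟨T, d', hT⟩ := hB
  refine ⟨⟨Matrix.fromBlocks S 0 0 T, Matrix.fromBlocks ((S⁻¹ : (Matrix _ _ ℂ)ˣ) : Matrix _ _ ℂ) 0 0
    ((T⁻¹ : (Matrix _ _ ℂ)ˣ) : Matrix _ _ ℂ), ?_, ?_⟩, Sum.elim d (-d'), ?_⟩
  · simp [Matrix.fromBlocks_multiply]
  · simp [Matrix.fromBlocks_multiply]
  · have hneg : (-B).map Complex.ofReal = -(B.map Complex.ofReal) := by
      ext i j; simp
    have hd : Matrix.diagonal (Sum.elim d (-d')) =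
        Matrix.fromBlocks (Matrix.diagonal d) 0 0 (-Matrix.diagonal d') := by
      rw [← Matrix.fromBlocks_diagonal, Matrix.diagonal_neg]
      rfl
    rw [_root_.horoMatrix, Matrix.fromBlocks_map, hneg, hS, hT, hd]
    simp only [Matrix.fromBlocks_multiply, Matrix.map_zero _ Complex.ofReal_zero, Matrix.mul_zero,
      Matrix.zero_mul, add_zero, zero_add, Matrix.mul_neg, Matrix.neg_mul, Units.inv_mk, neg_zero]

end Horo

theorem mainTheorem4 {m n : ℕ}
    (A : Matrix (Fin m) (Fin m) ℝ) (B : Matrix (Fin n) (Fin n) ℝ)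
    (hA : IsDiagonalizableOverC A) (hB : IsDiagonalizableOverC B)
    (hA' : IsHeintze A) (hB' : IsHeintze B) :
    (∃ b, IsJordanBasis A b) ∧ (∃ c, IsJordanBasis B c) ∧
      (∃ h, IsJordanBasis (horoMatrix A B) h) ∧
    ∀ b c h, IsJordanBasis A b → IsJordanBasis B c → IsJordanBasis (horoMatrix A B) h →
      ∃ δA δB : ℝ,
        δA = A.trace ∧ δB = B.trace ∧
        AbelianExt.HasVolumeEntropy (AbelianExt.leftInvariantMetric A b) δA ∧
        AbelianExt.HasVolumeEntropy (AbelianExt.leftInvariantMetric B c) δB ∧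
        AbelianExt.HasVolumeEntropy (AbelianExt.leftInvariantMetric (horoMatrix A B) h)
          (max δA δB) := by
  refine ⟨hA.exists_isJordanBasis, hB.exists_isJordanBasis,
    (hA.horoMatrix hB).exists_isJordanBasis, fun b c h hb hc hh => ?_⟩
  refine ⟨A.trace, B.trace, rfl, rfl, ?_, ?_, ?_⟩
  · rw [← hA'.growthRate_eq_trace hb]
    exact AbelianExt.hasVolumeEntropy_growthRate hb
  · rw [← hB'.growthRate_eq_trace hc]
    exact AbelianExt.hasVolumeEntropy_growthRate hc
  · rw [← growthRate_horoMatrix hA' hB' hh]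
    exact AbelianExt.hasVolumeEntropy_growthRate hh
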